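/- **Setting.** A *concurrent program* consists of finitely many processes, each a finite transition system whose transitions are labelled with instructions over a finite set of shared variables with a finite value domain: reads $\mathrm{rd}(x,d)$, writes $\mathrm{wr}(x,d)$, atomic read-writes $\mathrm{arw}(x,d,d')$, skips $\mathrm{nop}$ and memory fences $\mathrm{mf}$. A *TSO configuration* consists of a local state for each process, a FIFO store buffer of pending writes $(x,d)$ for each process, and a memory assigning a value to each variable. A write appends to the buffer of the process; a read $\mathrm{rd}(x,d)$ is enabled if $d$ is the value of the newest pending write on $x$ in the buffer of the process, or, if there is none, the value of $x$ in memory; $\mathrm{mf}$ requires an empty buffer; $\mathrm{arw}(x,d,d')$ requires an empty buffer and memory value $d$ for $x$, and sets it to $d'$. A *buffer update* moves the oldest pending write of some process to memory. In the *A-TSO game* of a program and a set of final local states, configurations are TSO configurations annotated with the player, A or B, whose turn it is. The players alternate; in her turn a player executes one enabled instruction of an arbitrary process. Player A may additionally perform any finite number of buffer updates before and after the instruction of her own turn; player B never updates. The final configurations are those of player A in which at least one process is in a final local state. Games are required to be deadlock-free (every configuration has a successor). Player B wins a play if it visits a final configuration, and player A wins it otherwise; a configuration is winning for a player if she has a strategy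 that wins against every strategy of her opponent. The *safety problem for the A-TSO game* is: given a program, a set of final local states (such that the game is deadlock-free) and a configuration, decide whether the configuration is winning for player A. A *perfect channel system* (PCS) $\mathcal L=(S,M,\delta)$ has finite sets $S$ of states and $M$ of messages and a transition relation $\delta\subseteq S\times(\{!m,?m: m\in M\}\cup\{\mathrm{nop}\})\times S$. Its configurations are pairs $(s,w)$ with $w\in M^*$; $!m$ appends $m$ to the FIFO channel, $?m$ is enabled if $m$ is the oldest message and removes it, and $\mathrm{nop}$ leaves the channel unchanged. A state $s$ is reachable from $s_0$ if some $(s,w)$ is reachable from $(s_0,\varepsilon)$. **The program $\mathcal P$ of a PCS.** It has variables $x_{\mathrm w},x_{\mathrm r},y$, values $M\uplus\{0,1,\bot\}$, and three processes. * Process 1 contains the states $S$ and, for each transition of $\mathcal L$, auxiliary states $h_i$ of its own, with these transitions: for $s\xrightarrow{\mathrm{nop}}s'$: $s\xrightarrow{\mathrm{nop}}h_1\xrightarrow{\mathrm{nop}}s'$; for $s\xrightarrow{!m}s'$: $s\xrightarrow{\mathrm{wr}(x_{\mathrm w},m)}h_1\xrightarrow{\mathrm{wr}(y,1)}s'$;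 for $s\xrightarrow{?m}s'$: $s\xrightarrow{\mathrm{nop}}h_1\xrightarrow{\mathrm{rd}(x_{\mathrm r},m)}h_2\xrightarrow{\mathrm{rd}(x_{\mathrm r},\bot)}h_3\xrightarrow{\mathrm{nop}}s'$ and $h_1\xrightarrow{\mathrm{mf}}h_4\xrightarrow{\mathrm{nop}}h_5\xrightarrow{\mathrm{rd}(x_{\mathrm w},\bot)}h_6$, and $h_1\xrightarrow{\mathrm{rd}(x_{\mathrm r},m')}h_6$ for every $m'\in M\setminus\{m\}$. * Process 2 has, for all $m\in M$, $q_1\xrightarrow{\mathrm{rd}(x_{\mathrm w},m)}q_m\xrightarrow{\mathrm{wr}(x_{\mathrm r},m)}q_3$, then $q_3\xrightarrow{\mathrm{wr}(x_{\mathrm w},\bot)}q_4\xrightarrow{\mathrm{mf}}q_5\xrightarrow{\mathrm{nop}}q_6\xrightarrow{\mathrm{rd}(y,1)}q_7\xrightarrow{\mathrm{wr}(y,0)}q_8\xrightarrow{\mathrm{mf}}q_9\xrightarrow{\mathrm{wr}(x_{\mathrm r},\bot)}q_{10}\xrightarrow{\mathrm{mf}}q_1$, and also $q_1\xrightarrow{\mathrm{rd}(x_{\mathrm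 w},m)}q_F$ and $q_9\xrightarrow{\mathrm{rd}(x_{\mathrm w},m)}q_F$ for all $m\in M$, $q_3\xrightarrow{\mathrm{rd}(y,1)}q_F$, $q_4\xrightarrow{\mathrm{nop}}q_F$, $q_5\xrightarrow{\mathrm{rd}(y,1)}q_F$. * Process 3 has only $\mathrm{nop}$ transitions: $r_1\to r_2$, $r_2\to r_3$, $r_2\to r_F$, $r_3\to r_3$, $r_F\to r_F$. **Theorem.** 1. The safety problem for the A-TSO game is undecidable: no computable function decides it correctly on all inputs whose game is deadlock-free. 2. Let $\mathcal L=(S,M,\delta)$ be a PCS, $s_0\in S$ and $S_F\subseteq S$, and let $\mathcal P$ be the program above with the set of final local states $S_F\cup\{q_F,r_F\}$. The A-TSO game of $\mathcal P$ is deadlock-free, and some state of $S_F$ is reachable from $s_0$ in $\mathcal L$ if and only if player B wins the game from the configuration in which it is B's turn, the local states are $(s_0,q_1,r_1)$, all buffers are empty, and the memory is $x_{\mathrm w}\mapsto\bot$, $x_{\mathrm r}\mapsto\bot$, $y\mapsto 0$. -/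

import Mathlib

/-! ### Safety games -/

/-- The two players. Player `B` tries to reach a final configuration, player `A` tries to avoid it. -/
inductive Player
  | A
  | B
  deriving DecidableEq

/-- The opponent of a player. -/
def Player.other : Player → Player
  | .A => .B
  | .B => .A

/-- A game on the set `C` of configurations: every configuration is owned by one player, and
the final configurations are owned by player `A`. Deadlock-freedom is `Game.DeadlockFree`. -/
structure Game (C : Type) where
  owner : C → Player
  move : C → C → Prop
  final : Set C
  final_owner : ∀ c ∈ final, owner c = Player.A

namespace Game

variable {C : Type}

/-- Every configuration has a successor. -/
def DeadlockFree (G : Game C) : Prop := ∀ c, ∃ d, G.move c d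

/-- A (history-dependent) strategy of player `p`. `next h c` is the move chosen after the
history `h ++ [c]`, where `c` is the current configuration; it has to be a legal move whenever
`h ++ [c]` is a path of the game and `c` is owned by `p`. The other values are irrelevant. -/
structure Strategy (G : Game C) (p : Player) where
  next : List C → C → C
  legal : ∀ (h : List C) (c : C),
    (h ++ [c]).IsChain G.move → G.owner c = p → G.move c (next h c)

/-- The past and the current configuration after `n` moves of the play that two strategies
induce from `c`. -/
def history (G : Game C) (σ : G.Strategy .A) (τ : G.Strategy .B) (c : C) : ℕ → List C × C
  | 0 => ([], c)
  | n + 1 =>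
    let h := (history G σ τ c n).1
    let d := (history G σ τ c n).2
    (h ++ [d], match G.owner d with
      | .A => σ.next h d
      | .B => τ.next h d)

/-- The play induced by two strategies from `c`. -/
def play (G : Game C) (σ : G.Strategy .A) (τ : G.Strategy .B) (c : C) (n : ℕ) : C :=
  (G.history σ τ c n).2

/-- `c` is winning for player `A`: she has a strategy that avoids the final configurations
against every strategy of player `B`. -/
def WinsA (G : Game C) (c : C) : Prop :=
  ∃ σ : G.Strategy .A, ∀ τ : G.Strategy .B, ∀ n, G.play σ τ c n ∉ G.final

/-- `c` is winning for player `B`: she has a strategy that reaches a final configuration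
against every strategy of player `A`. -/
def WinsB (G : Game C) (c : C) : Prop :=
  ∃ τ : G.Strategy .B, ∀ σ : G.Strategy .A, ∃ n, G.play σ τ c n ∈ G.final

end Game

/-! ### Concurrent programs and their TSO semantics -/

/-- Instructions over the shared variables `V` with values in `D`: read, write, atomic
read-write, skip and memory fence. -/
inductive Instr (V D : Type)
  | rd (x : V) (d : D)
  | wr (x : V) (d : D)
  | arw (x : V) (d d' : D)
  | nop
  | mf

/-- A concurrent program: one labelled transition relation per process, where `Q i` is the set
of local states of process `i`. -/
structure Program (ι V D : Type) (Q : ι → Type) where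
  trans : (i : ι) → Q i → Instr V D → Q i → Prop

/-- TSO configurations: a global state, a store buffer for each process, and the memory.
The head of a buffer list is the newest pending write, its last entry is the oldest one. -/
structure TSOConf (ι V D : Type) (Q : ι → Type) where
  state : (i : ι) → Q i
  buf : ι → List (V × D)
  mem : V → D

namespace Program

variable {ι V D : Type} {Q : ι → Type} [DecidableEq ι] [DecidableEq V]

/-- Execution of an instruction by one of the processes. -/
inductive Step (P : Program ι V D Q) : TSOConf ι V D Q → TSOConf ι V D Q → Prop
  | read_own_write (c : TSOConf ι V D Q) (i : ι) (q : Q i) (x : V) (d : D) (w : List (V × D)) :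
      P.trans i (c.state i) (.rd x d) q →
      (c.buf i).filter (fun e => e.1 = x) = (x, d) :: w →
      Step P c ⟨Function.update c.state i q, c.buf, c.mem⟩
  | read_from_memory (c : TSOConf ι V D Q) (i : ι) (q : Q i) (x : V) (d : D) :
      P.trans i (c.state i) (.rd x d) q →
      (c.buf i).filter (fun e => e.1 = x) = [] → c.mem x = d →
      Step P c ⟨Function.update c.state i q, c.buf, c.mem⟩
  | write (c : TSOConf ι V D Q) (i : ι) (q : Q i) (x : V) (d : D) :
      P.trans i (c.state i) (.wr x d) q →
      Step P c
        ⟨Function.update c.state i q, Function.update c.buf i ((x, d) :: c.buf i), c.mem⟩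
  | arw (c : TSOConf ι V D Q) (i : ι) (q : Q i) (x : V) (d d' : D) :
      P.trans i (c.state i) (.arw x d d') q → c.buf i = [] → c.mem x = d →
      Step P c ⟨Function.update c.state i q, c.buf, Function.update c.mem x d'⟩
  | skip (c : TSOConf ι V D Q) (i : ι) (q : Q i) :
      P.trans i (c.state i) .nop q →
      Step P c ⟨Function.update c.state i q, c.buf, c.mem⟩
  | memory_fence (c : TSOConf ι V D Q) (i : ι) (q : Q i) :
      P.trans i (c.state i) .mf q → c.buf i = [] →
      Step P c ⟨Function.update c.state i q, c.buf, c.mem⟩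

end Program

/-- A single buffer update: the oldest pending write of some process goes to the memory. -/
inductive TSOConf.Update {ι V D : Type} {Q : ι → Type} [DecidableEq ι] [DecidableEq V] :
    TSOConf ι V D Q → TSOConf ι V D Q → Prop
  | intro (c : TSOConf ι V D Q) (i : ι) (x : V) (d : D) (w : List (V × D)) :
      c.buf i = w ++ [(x, d)] →
      Update c ⟨c.state, Function.update c.buf i w, Function.update c.mem x d⟩

/-- Any finite number (possibly zero) of buffer updates. -/
def TSOConf.Updates {ι V D : Type} {Q : ι → Type} [DecidableEq ι] [DecidableEq V] :
    TSOConf ι V D Q → TSOConf ι V D Q → Prop :=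
  Relation.ReflTransGen TSOConf.Update

namespace Program

variable {ι V D : Type} {Q : ι → Type} [DecidableEq ι] [DecidableEq V]

/-- The TSO game of a program and a set `F` of final local states. The players alternate in
executing one instruction of an arbitrary process; `before p` (`after p`) says that player `p` may
update buffers before (after) executing the instruction of her turn. Final are the configurations of
player `A` in which at least one process is in a state of `F`. -/
def tsoGame (P : Program ι V D Q) (F : Set (Σ i, Q i)) (before after : Player → Prop) :
    Game (Player × TSOConf ι V D Q) where
  owner := Prod.fst
  move g g' := g'.1 = g.1.other ∧ ∃ c c' : TSOConf ι V D Q,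
    (g.2 = c ∨ before g.1 ∧ TSOConf.Updates g.2 c) ∧ P.Step c c' ∧
    (c' = g'.2 ∨ after g.1 ∧ TSOConf.Updates c' g'.2)
  final := {g | g.1 = .A ∧ ∃ i, (⟨i, g.2.state i⟩ : Σ i, Q i) ∈ F}
  final_owner _ h := h.1

/-- The A-TSO game: player `A` may update before and after her turn, player `B` never. -/
def atsoGame (P : Program ι V D Q) (F : Set (Σ i, Q i)) : Game (Player × TSOConf ι V D Q) :=
  P.tsoGame F (fun p => p = .A) (fun p => p = .A)

end Program

/-! ### The safety problem of the A-TSO game as a decision problem -/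

/-- Instructions as a sum of products, used to encode them. -/
def Instr.equivSum (V D : Type) :
    Instr V D ≃ ((V × D) ⊕ (V × D)) ⊕ ((V × D × D) ⊕ Bool) where
  toFun
    | .rd x d => .inl (.inl (x, d))
    | .wr x d => .inl (.inr (x, d))
    | .arw x d d' => .inr (.inl (x, d, d'))
    | .nop => .inr (.inr false)
    | .mf => .inr (.inr true)
  invFun
    | .inl (.inl (x, d)) => .rd x d
    | .inl (.inr (x, d)) => .wr x d
    | .inr (.inl (x, d, d')) => .arw x d d'
    | .inr (.inr false) => .nop
    | .inr (.inr true) => .mf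
  left_inv i := by cases i <;> rfl
  right_inv s := by rcases s with (_ | _) | (_ | (_ | _)) <;> rfl

instance Instr.primcodable {V D : Type} [Primcodable V] [Primcodable D] :
    Primcodable (Instr V D) :=
  Primcodable.ofEquiv _ (Instr.equivSum V D)

/-- Players as Booleans, used to encode them. -/
def Player.equivBool : Player ≃ Bool where
  toFun
    | .A => true
    | .B => false
  invFun
    | true => .A
    | false => .B
  left_inv p := by cases p <;> rfl
  right_inv b := by cases b <;> rfl

instance Player.primcodable : Primcodable Player := Primcodable.ofEquiv _ Player.equivBool

/-- Renaming the variables and values of an instruction. -/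
def Instr.map {V D V' D' : Type} (f : V → V') (g : D → D') : Instr V D → Instr V' D'
  | .rd x d => .rd (f x) (g d)
  | .wr x d => .wr (f x) (g d)
  | .arw x d d' => .arw (f x) (g d) (g d')
  | .nop => .nop
  | .mf => .mf

/-- Finite description of a process: the number of its states and the list of its transitions. -/
abbrev ProcCode : Type := ℕ × List (ℕ × Instr ℕ ℕ × ℕ)

/-- Finite description of a program: the number of variables, the size of the data domain, and
the processes. Up to renaming, these are all programs with finitely many processes, local states,
variables and values. -/
abbrev ProgCode : Type := ℕ × ℕ × List ProcCode

namespace ProgCode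

/-- Process identifiers of the described program. -/
abbrev Idx (P : ProgCode) : Type := Fin P.2.2.length

/-- Variables of the described program. -/
abbrev Var (P : ProgCode) : Type := Fin P.1

/-- Values of the described program. -/
abbrev Val (P : ProgCode) : Type := Fin P.2.1

/-- Local states of process `i` of the described program. -/
abbrev LocalState (P : ProgCode) (i : P.Idx) : Type := Fin (P.2.2.get i).1

/-- The described program; entries of the transition lists that mention a state, variable or value
out of range have no effect. -/
def toProgram (P : ProgCode) : Program P.Idx P.Var P.Val P.LocalState where
  trans i q a q' :=
    ((q : ℕ), Instr.map (V := P.Var) (D := P.Val) Fin.val Fin.val a, (q' : ℕ)) ∈ (P.2.2.get i).2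

/-- The set of final local states described by a list of pairs (process, state). -/
def finalStates (P : ProgCode) (F : List (ℕ × ℕ)) : Set (Σ i, P.LocalState i) :=
  {s | ((s.1 : ℕ), (s.2 : ℕ)) ∈ F}

/-- The A-TSO game of a described program and a described set of final local states. -/
def game (P : ProgCode) (F : List (ℕ × ℕ)) :
    Game (Player × TSOConf P.Idx P.Var P.Val P.LocalState) :=
  P.toProgram.atsoGame (P.finalStates F)

end ProgCode

/-- Finite description of a game configuration: the player whose turn it is, the local states, the
buffers (newest write first) and the memory values. -/
abbrev ConfCode : Type := Player × List ℕ × List (List (ℕ × ℕ)) × List ℕ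

/-- The finite description of a game configuration. -/
def ProgCode.encodeConf (P : ProgCode)
    (g : Player × TSOConf P.Idx P.Var P.Val P.LocalState) : ConfCode :=
  (g.1, List.ofFn (fun i => (g.2.state i : ℕ)),
    List.ofFn (fun i => (g.2.buf i).map (fun e => ((e.1 : ℕ), (e.2 : ℕ)))),
    List.ofFn (fun x => (g.2.mem x : ℕ)))

/-- The safety problem for the A-TSO game is decidable: some computable function decides, given
(descriptions of) a program, a set of final local states and a game configuration, whether the
configuration is winning for player `A`. As games are deadlock-free by definition, the function
need only be correct for inputs whose game is deadlock-free. -/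
def ATSOSafetyDecidable : Prop :=
  ∃ f : ProgCode × List (ℕ × ℕ) × ConfCode → Bool, Computable f ∧
    ∀ (P : ProgCode) (F : List (ℕ × ℕ)) (g : Player × TSOConf P.Idx P.Var P.Val P.LocalState),
      (P.game F).DeadlockFree → (f (P, F, P.encodeConf g) = true ↔ (P.game F).WinsA g)

/-! ### Perfect channel systems -/

/-- Channel operations: send, receive, skip. -/
inductive ChanOp (M : Type)
  | send (m : M)
  | recv (m : M)
  | nop

/-- A perfect channel system with states `S` and messages `M`. -/
structure PCS (S M : Type) where
  trans : S → ChanOp M → S → Prop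

namespace PCS

variable {S M : Type}

/-- One step of a channel system; messages are sent at the front of the word and received from
its end. -/
inductive Step (L : PCS S M) : S × List M → S × List M → Prop
  | send (s s' : S) (m : M) (w : List M) : L.trans s (.send m) s' → Step L (s, w) (s', m :: w)
  | recv (s s' : S) (m : M) (w : List M) : L.trans s (.recv m) s' → Step L (s, w ++ [m]) (s', w)
  | skip (s s' : S) (w : List M) : L.trans s .nop s' → Step L (s, w) (s', w)

/-- State `s` is reachable from the configuration `c`. -/
def StateReachable (L : PCS S M) (c : S × List M) (s : S) : Prop :=
  ∃ w, Relation.ReflTransGen L.Step c (s, w)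

end PCS

/-! ### The three-process program of a perfect channel system -/

/-- The three processes. -/
inductive PIdx
  | p1
  | p2
  | p3
  deriving DecidableEq

/-- The three shared variables. -/
inductive PVar
  | xwr
  | xrd
  | y
  deriving DecidableEq

/-- The data domain: the messages and three further values. -/
inductive PVal (M : Type)
  | msg (m : M)
  | zero
  | one
  | bot

/-- The auxiliary states of a simulated transition. -/
inductive Aux
  | h1
  | h2
  | h3
  | h4
  | h5
  | h6

/-- States of the first process: the channel states, and for each triple `(s, o, s')` auxiliary
states of its own (they are isolated if the triple is not a transition). -/
inductive P1State (S M : Type)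
  | chan (s : S)
  | aux (s : S) (o : ChanOp M) (s' : S) (h : Aux)

/-- States of the second process. -/
inductive P2State (M : Type)
  | q1
  | qmsg (m : M)
  | q3
  | q4
  | q5
  | q6
  | q7
  | q8
  | q9
  | q10
  | qF

/-- States of the third process. -/
inductive P3State
  | r1
  | r2
  | r3
  | rF

/-- The local states of the three processes. -/
def PState (S M : Type) : PIdx → Type
  | .p1 => P1State S M
  | .p2 => P2State M
  | .p3 => P3State

namespace PCS

variable {S M : Type}

/-- Transitions of the first process, for each transition of the channel system. -/
inductive Trans1 (L : PCS S M) : P1State S M → Instr PVar (PVal M) → P1State S M → Prop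
  | skip_start (s s' : S) : L.trans s .nop s' →
      Trans1 L (.chan s) .nop (.aux s .nop s' .h1)
  | skip_end (s s' : S) : L.trans s .nop s' →
      Trans1 L (.aux s .nop s' .h1) .nop (.chan s')
  | send_start (s s' : S) (m : M) : L.trans s (.send m) s' →
      Trans1 L (.chan s) (.wr .xwr (.msg m)) (.aux s (.send m) s' .h1)
  | send_end (s s' : S) (m : M) : L.trans s (.send m) s' →
      Trans1 L (.aux s (.send m) s' .h1) (.wr .y .one) (.chan s')
  | recv_start (s s' : S) (m : M) : L.trans s (.recv m) s' →
      Trans1 L (.chan s) .nop (.aux s (.recv m) s' .h1)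
  | recv_read (s s' : S) (m : M) : L.trans s (.recv m) s' →
      Trans1 L (.aux s (.recv m) s' .h1) (.rd .xrd (.msg m)) (.aux s (.recv m) s' .h2)
  | recv_reset (s s' : S) (m : M) : L.trans s (.recv m) s' →
      Trans1 L (.aux s (.recv m) s' .h2) (.rd .xrd .bot) (.aux s (.recv m) s' .h3)
  | recv_end (s s' : S) (m : M) : L.trans s (.recv m) s' →
      Trans1 L (.aux s (.recv m) s' .h3) .nop (.chan s')
  | recv_empty (s s' : S) (m : M) : L.trans s (.recv m) s' →
      Trans1 L (.aux s (.recv m) s' .h1) .mf (.aux s (.recv m) s' .h4)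
  | recv_empty' (s s' : S) (m : M) : L.trans s (.recv m) s' →
      Trans1 L (.aux s (.recv m) s' .h4) .nop (.aux s (.recv m) s' .h5)
  | recv_empty'' (s s' : S) (m : M) : L.trans s (.recv m) s' →
      Trans1 L (.aux s (.recv m) s' .h5) (.rd .xwr .bot) (.aux s (.recv m) s' .h6)
  | recv_wrong (s s' : S) (m m' : M) : L.trans s (.recv m) s' → m' ≠ m →
      Trans1 L (.aux s (.recv m) s' .h1) (.rd .xrd (.msg m')) (.aux s (.recv m) s' .h6)

end PCS

/-- Transitions of the second process. -/
inductive Trans2 {M : Type} : P2State M → Instr PVar (PVal M) → P2State M → Prop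
  | read_msg (m : M) : Trans2 .q1 (.rd .xwr (.msg m)) (.qmsg m)
  | write_msg (m : M) : Trans2 (.qmsg m) (.wr .xrd (.msg m)) .q3
  | t3 : Trans2 .q3 (.wr .xwr .bot) .q4
  | t4 : Trans2 .q4 .mf .q5
  | t5 : Trans2 .q5 .nop .q6
  | t6 : Trans2 .q6 (.rd .y .one) .q7
  | t7 : Trans2 .q7 (.wr .y .zero) .q8
  | t8 : Trans2 .q8 .mf .q9
  | t9 : Trans2 .q9 (.wr .xrd .bot) .q10
  | t10 : Trans2 .q10 .mf .q1
  | final1 (m : M) : Trans2 .q1 (.rd .xwr (.msg m)) .qF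
  | final3 : Trans2 .q3 (.rd .y .one) .qF
  | final4 : Trans2 .q4 .nop .qF
  | final5 : Trans2 .q5 (.rd .y .one) .qF
  | final9 (m : M) : Trans2 .q9 (.rd .xwr (.msg m)) .qF

/-- Transitions of the third process. -/
inductive Trans3 {M : Type} : P3State → Instr PVar (PVal M) → P3State → Prop
  | start : Trans3 .r1 .nop .r2
  | toA : Trans3 .r2 .nop .r3
  | toB : Trans3 .r2 .nop .rF
  | loopA : Trans3 .r3 .nop .r3
  | loopB : Trans3 .rF .nop .rF

namespace PCS

variable {S M : Type}

/-- The three-process program that simulates a perfect channel system. -/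
def program (L : PCS S M) : Program PIdx PVar (PVal M) (PState S M) where
  trans
    | .p1 => L.Trans1
    | .p2 => Trans2
    | .p3 => Trans3

/-- The final local states of the program: the final channel states, `qF` and `rF`. -/
def programFinal (SF : Set S) : Set (Σ i, PState S M i) :=
  {p | (∃ s ∈ SF, p = ⟨.p1, P1State.chan s⟩) ∨ p = ⟨.p2, P2State.qF⟩ ∨ p = ⟨.p3, P3State.rF⟩}

/-- The initial configuration of the program for the initial channel state `s₀`. -/
def programInit (s₀ : S) : TSOConf PIdx PVar (PVal M) (PState S M) where
  state
    | .p1 => P1State.chan s₀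
    | .p2 => P2State.q1
    | .p3 => P3State.r1
  buf _ := []
  mem
    | .xwr => .bot
    | .xrd => .bot
    | .y => .zero

end PCS

/-!
The theorem reduces reachability in perfect channel systems to A-TSO games: in the program of a
channel system the store buffer of the first process plays the role of the channel, and the second
process transports the oldest message from the variable `xwr` to the variable `xrd`, where the first
process receives it.

*Player B wins if a final state is reachable* (`PCS.forcesConf_of_reachable`). She executes a run of
the channel system, and every deviation of player A is punished. If player A moves the third process,
player B moves it to `rF`. If player A moves a message to `xwr` too early, the second process reads
it in `q1` or `q9` and enters `qF`. Player A may let the second process fetch the oldest message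
before it is needed, but then this process stops in `q3` until the message is received: if player A
moves it to `q4`, player B moves it to `qF`, and if she updates the memory with further messages, the
second process reads, in `q3` or `q5`, the write `y := 1` that follows every message. So at the turns
of player B between two transitions of the channel system, the situation is one of the two described
by `PCS.ForcesConf`, or she wins at once. The invariants are closed under buffer updates, since player
A may do any number of them before and after her move.

*Player A wins if no final state is reachable* (`PCS.isSafe`). She updates as late as possible
and answers every move of player B by the next move of the same process, or by fetching the oldest
message if the first process starts to receive. If the channel is empty or the message is wrong, the
first process ends in the dead end `h6`. The turns of player B that can occur form a safe set.

Winning strategies are obtained from an attractor for player B (`Game.Attr.winsB`) and from a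
safe set for player A (`Game.IsSafe.winsA`); both notions are transported along isomorphisms of games.

*Undecidability.* A channel system simulates a machine with several stacks
(`Turing.TM2`): the channel contains the stacks one after the other, up to rotation
(`StackQueue.eval_dom_of_reachable`, `StackQueue.reachable_of_eval_dom`). Mathlib translates every
partial recursive function to such a machine, in particular a function that is defined exactly on
the codes of the programs that halt. The resulting program is fixed; the input only occurs in the
store buffer of the first process of the start configuration, which is not required to be empty.
Hence the reduction is computable as soon as the map from an input to the contents of that buffer is
(`StackQueue.computable_input`), and a decision procedure for the safety problem would decide the
halting problem.
-/

/-! ### Attractors and safe sets of games -/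

namespace Game

variable {C : Type}

/-- The configurations from which player `B` can force a visit to a final configuration: the least
set that contains the final configurations, the configurations of `B` with some successor in the
set and the configurations of `A` with all successors in the set. -/
inductive Attr (G : Game C) : C → Prop
  | final {c : C} : c ∈ G.final → Attr G c
  | moveB {c : C} (d : C) : G.owner c = .B → G.move c d → Attr G d → Attr G c
  | moveA {c : C} : G.owner c = .A → (∀ d, G.move c d → Attr G d) → Attr G c

/-- The attractor, stratified by the ordinal stage at which a configuration enters it. -/
inductive AttrRank (G : Game C) : Ordinal.{0} → C → Prop
  | final {c : C} (o : Ordinal.{0}) : c ∈ G.final → AttrRank G o c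
  | moveB {c : C} {o o' : Ordinal.{0}} (d : C) : o' < o → G.owner c = .B → G.move c d →
      AttrRank G o' d → AttrRank G o c
  | moveA {c : C} {o : Ordinal.{0}} (r : C → Ordinal.{0}) : G.owner c = .A →
      (∀ d, G.move c d → r d < o) → (∀ d, G.move c d → AttrRank G (r d) d) → AttrRank G o c

theorem Attr.exists_rank {G : Game C} {c : C} (h : G.Attr c) : ∃ o, G.AttrRank o c := by
  induction h with
  | final h => exact ⟨0, .final _ h⟩
  | moveB d h₁ h₂ _ ih =>
    obtain ⟨o, ho⟩ := ih
    exact ⟨_, .moveB d (Order.lt_succ o) h₁ h₂ ho⟩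
  | @moveA c h₁ _ ih =>
    choose! r hr using ih
    refine ⟨Order.succ (⨆ d, r d), .moveA r h₁ (fun d _ => ?_) hr⟩
    exact Order.lt_succ_of_le (Ordinal.le_iSup r d)

/-- The first stage of the attractor that contains `c`. -/
noncomputable def rank (G : Game C) (c : C) : Ordinal.{0} := sInf {o | G.AttrRank o c}

theorem Attr.attrRank_rank {G : Game C} {c : C} (h : G.Attr c) : G.AttrRank (G.rank c) c :=
  csInf_mem (s := {o | G.AttrRank o c}) h.exists_rank

theorem AttrRank.rank_le {G : Game C} {c : C} {o : Ordinal.{0}} (h : G.AttrRank o c) :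
    G.rank c ≤ o :=
  csInf_le' h

theorem AttrRank.attr {G : Game C} {c : C} {o : Ordinal.{0}} (h : G.AttrRank o c) : G.Attr c := by
  induction h with
  | final _ h => exact .final h
  | moveB d _ h₁ h₂ _ ih => exact .moveB d h₁ h₂ ih
  | moveA r h₁ _ _ ih => exact .moveA h₁ ih

theorem Attr.exists_move {G : Game C} {c : C} (h : G.Attr c) (hc : G.owner c = .B) :
    ∃ d, G.move c d ∧ G.Attr d ∧ G.rank d < G.rank c := by
  cases h.attrRank_rank with
  | final _ hf => simp [G.final_owner c hf] at hc
  | moveB d ho _ hm hd => exact ⟨d, hm, hd.attr, hd.rank_le.trans_lt ho⟩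
  | moveA r hA => simp [hA] at hc

theorem Attr.forall_move {G : Game C} {c : C} (h : G.Attr c) (hc : G.owner c = .A)
    (hf : c ∉ G.final) {d : C} (hm : G.move c d) : G.Attr d ∧ G.rank d < G.rank c := by
  cases h.attrRank_rank with
  | final _ hf' => exact absurd hf' hf
  | moveB d ho hB => simp [hB] at hc
  | moveA r _ hr hd => exact ⟨(hd d hm).attr, (hd d hm).rank_le.trans_lt (hr d hm)⟩

theorem history_isChain (G : Game C) (σ : G.Strategy .A) (τ : G.Strategy .B) (c : C) (n : ℕ) :
    ((G.history σ τ c n).1 ++ [(G.history σ τ c n).2]).IsChain G.move := by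
  induction n with
  | zero => simp [history]
  | succ n ih =>
    simp only [history]
    rw [List.isChain_append]
    refine ⟨ih, by simp, ?_⟩
    intro x hx y hy
    simp only [List.getLast?_append, List.getLast?_singleton, Option.some_or, Option.mem_def,
      Option.some.injEq, List.head?_cons] at hx hy
    subst hx hy
    split
    · exact σ.legal _ _ ih ‹_›
    · exact τ.legal _ _ ih ‹_›

theorem play_succ_of_owner_A (G : Game C) (σ : G.Strategy .A) (τ : G.Strategy .B) (c : C) (n : ℕ)
    (h : G.owner (G.play σ τ c n) = .A) :
    G.play σ τ c (n + 1) = σ.next (G.history σ τ c n).1 (G.play σ τ c n) := by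
  simp only [play, history] at h ⊢
  rw [h]

theorem play_succ_of_owner_B (G : Game C) (σ : G.Strategy .A) (τ : G.Strategy .B) (c : C) (n : ℕ)
    (h : G.owner (G.play σ τ c n) = .B) :
    G.play σ τ c (n + 1) = τ.next (G.history σ τ c n).1 (G.play σ τ c n) := by
  simp only [play, history] at h ⊢
  rw [h]

theorem move_play (G : Game C) (σ : G.Strategy .A) (τ : G.Strategy .B) (c : C) (n : ℕ) :
    G.move (G.play σ τ c n) (G.play σ τ c (n + 1)) := by
  cases h : G.owner (G.play σ τ c n) with
  | A =>
    rw [G.play_succ_of_owner_A σ τ c n h]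
    exact σ.legal _ _ (G.history_isChain σ τ c n) h
  | B =>
    rw [G.play_succ_of_owner_B σ τ c n h]
    exact τ.legal _ _ (G.history_isChain σ τ c n) h

open Classical in
/-- The positional strategy that moves to a configuration satisfying `good c` whenever there is
one. -/
noncomputable def Strategy.toward {G : Game C} (hG : G.DeadlockFree) (p : Player)
    (good : C → C → Prop) : G.Strategy p where
  next _ c := if h : ∃ d, G.move c d ∧ good c d then h.choose else (hG c).choose
  legal _ c _ _ := by
    split
    · rename_i h
      exact h.choose_spec.1
    · exact (hG c).choose_spec

theorem Strategy.toward_good {G : Game C} (hG : G.DeadlockFree) (p : Player)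
    (good : C → C → Prop) (h : List C) (c : C) (hc : ∃ d, G.move c d ∧ good c d) :
    good c ((Strategy.toward hG p good).next h c) := by
  simp only [toward, dif_pos hc]
  exact hc.choose_spec.2

/-- From the attractor player `B` wins: her strategy decreases the rank in every turn, and player
`A` cannot avoid decreasing it. -/
theorem Attr.winsB {G : Game C} (hG : G.DeadlockFree) {c : C} (h : G.Attr c) : G.WinsB c := by
  refine ⟨.toward hG .B fun c d => G.Attr d ∧ G.rank d < G.rank c, fun σ => ?_⟩
  set τ : G.Strategy .B := .toward hG .B fun c d => G.Attr d ∧ G.rank d < G.rank c with hτ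
  have key : ∀ o : Ordinal.{0}, ∀ n, G.Attr (G.play σ τ c n) → G.rank (G.play σ τ c n) = o →
      ∃ m, G.play σ τ c m ∈ G.final := by
    intro o
    induction o using WellFoundedLT.induction with
    | _ o ih =>
      intro n hn ho
      by_cases hf : G.play σ τ c n ∈ G.final
      · exact ⟨n, hf⟩
      · have : G.Attr (G.play σ τ c (n + 1)) ∧
            G.rank (G.play σ τ c (n + 1)) < G.rank (G.play σ τ c n) := by
          cases hc : G.owner (G.play σ τ c n) with
          | A => exact hn.forall_move hc hf (G.move_play σ τ c n)
          | B =>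
            rw [G.play_succ_of_owner_B σ τ c n hc]
            exact Strategy.toward_good hG .B (fun c d => G.Attr d ∧ G.rank d < G.rank c) _ _
              (hn.exists_move hc)
        exact ih _ (ho ▸ this.2) (n + 1) this.1 rfl
  exact key _ 0 h rfl

/-- A set that avoids the final configurations, that `B` cannot leave and that `A` can choose not
to leave. -/
structure IsSafe (G : Game C) (X : Set C) : Prop where
  not_final : ∀ c ∈ X, c ∉ G.final
  forall_move : ∀ c ∈ X, G.owner c = .B → ∀ d, G.move c d → d ∈ X
  exists_move : ∀ c ∈ X, G.owner c = .A → ∃ d, G.move c d ∧ d ∈ X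

theorem IsSafe.winsA {G : Game C} (hG : G.DeadlockFree) {X : Set C} (hX : G.IsSafe X) {c : C}
    (hc : c ∈ X) : G.WinsA c := by
  refine ⟨.toward hG .A fun _ d => d ∈ X, fun τ n => hX.not_final _ ?_⟩
  induction n with
  | zero => exact hc
  | succ n ih =>
    cases ho : G.owner (G.play (.toward hG .A fun _ d => d ∈ X) τ c n) with
    | A =>
      rw [G.play_succ_of_owner_A _ τ c n ho]
      exact Strategy.toward_good hG .A (fun _ d => d ∈ X) _ _ (hX.exists_move _ ih ho)
    | B => exact hX.forall_move _ ih ho _ (G.move_play _ τ c n)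

theorem WinsA.not_winsB {G : Game C} {c : C} (h : G.WinsA c) : ¬ G.WinsB c := by
  rintro ⟨τ, hτ⟩
  obtain ⟨σ, hσ⟩ := h
  obtain ⟨n, hn⟩ := hτ σ
  exact hσ τ n hn

/-! ### Isomorphic games -/

theorem DeadlockFree.of_equiv {C' : Type} {G : Game C} {G' : Game C'} (e : C ≃ C')
    (hm : ∀ c d, G'.move (e c) (e d) ↔ G.move c d) (h : G.DeadlockFree) : G'.DeadlockFree := by
  intro c'
  obtain ⟨d, hd⟩ := h (e.symm c')
  exact ⟨e d, by simpa using (hm _ _).2 hd⟩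

theorem Attr.of_equiv {C' : Type} {G : Game C} {G' : Game C'} (e : C ≃ C')
    (ho : ∀ c, G'.owner (e c) = G.owner c) (hm : ∀ c d, G'.move (e c) (e d) ↔ G.move c d)
    (hf : ∀ c, e c ∈ G'.final ↔ c ∈ G.final) {c : C} (h : G.Attr c) : G'.Attr (e c) := by
  induction h with
  | final h => exact .final ((hf _).2 h)
  | moveB d hB hd _ ih => exact .moveB (e d) ((ho _).trans hB) ((hm _ _).2 hd) ih
  | moveA hA _ ih =>
    refine .moveA ((ho _).trans hA) fun d' hd' => ?_
    obtain ⟨d, rfl⟩ := e.surjective d'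
    exact ih d ((hm _ _).1 hd')

theorem IsSafe.of_equiv {C' : Type} {G : Game C} {G' : Game C'} (e : C ≃ C')
    (ho : ∀ c, G'.owner (e c) = G.owner c) (hm : ∀ c d, G'.move (e c) (e d) ↔ G.move c d)
    (hf : ∀ c, e c ∈ G'.final ↔ c ∈ G.final) {X : Set C} (hX : G.IsSafe X) :
    G'.IsSafe (e '' X) where
  not_final := by
    rintro _ ⟨c, hc, rfl⟩
    exact fun h => hX.not_final c hc ((hf c).1 h)
  forall_move := by
    rintro _ ⟨c, hc, rfl⟩ hB d' hd'
    obtain ⟨d, rfl⟩ := e.surjective d'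
    exact ⟨d, hX.forall_move c hc ((ho c).symm.trans hB) d ((hm c d).1 hd'), rfl⟩
  exists_move := by
    rintro _ ⟨c, hc, rfl⟩ hA
    obtain ⟨d, hd, hdX⟩ := hX.exists_move c hc ((ho c).symm.trans hA)
    exact ⟨e d, (hm c d).2 hd, d, hdX, rfl⟩

end Game

/-! ### TSO steps as effects of instructions -/

/-- The value that a process with store buffer `b` reads from variable `x` in the memory `m`. -/
def readVal {V D : Type} [DecidableEq V] (b : List (V × D)) (m : V → D) (x : V) : D :=
  ((b.filter (fun e => e.1 = x)).head?.map Prod.snd).getD (m x)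

/-- The effect of an instruction: `a.Eff b m b' m'` if the instruction `a` is enabled with store
buffer `b` of the executing process and memory `m`, and turns them into `b'` and `m'`. -/
def Instr.Eff {V D : Type} [DecidableEq V] (a : Instr V D) (b : List (V × D)) (m : V → D)
    (b' : List (V × D)) (m' : V → D) : Prop :=
  match a with
  | .rd x d => readVal b m x = d ∧ b' = b ∧ m' = m
  | .wr x d => b' = (x, d) :: b ∧ m' = m
  | .arw x d d' => b = [] ∧ m x = d ∧ b' = b ∧ m' = Function.update m x d'
  | .nop => b' = b ∧ m' = m
  | .mf => b = [] ∧ b' = b ∧ m' = m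

theorem Program.step_iff {ι V D : Type} {Q : ι → Type} [DecidableEq ι] [DecidableEq V]
    {P : Program ι V D Q} {c c' : TSOConf ι V D Q} :
    P.Step c c' ↔ ∃ i a q b m, P.trans i (c.state i) a q ∧ a.Eff (c.buf i) c.mem b m ∧
      c' = ⟨Function.update c.state i q, Function.update c.buf i b, m⟩ := by
  constructor
  · intro h
    cases h with
    | read_own_write i q x d w ht hb =>
      exact ⟨i, _, q, c.buf i, c.mem, ht, by simp [Instr.Eff, readVal, hb], by simp⟩
    | read_from_memory i q x d ht hb hm =>
      exact ⟨i, _, q, c.buf i, c.mem, ht, by simp [Instr.Eff, readVal, hb, hm], by simp⟩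
    | write i q x d ht => exact ⟨i, _, q, _, c.mem, ht, by simp [Instr.Eff], rfl⟩
    | arw i q x d d' ht hb hm =>
      exact ⟨i, _, q, c.buf i, Function.update c.mem x d', ht, by simp [Instr.Eff, hb, hm], by simp⟩
    | skip i q ht => exact ⟨i, _, q, c.buf i, c.mem, ht, by simp [Instr.Eff], by simp⟩
    | memory_fence i q ht hb =>
      exact ⟨i, _, q, c.buf i, c.mem, ht, by simp [Instr.Eff, hb], by simp⟩
  · rintro ⟨i, a, q, b, m, ht, he, rfl⟩
    cases a with
    | rd x d =>
      obtain ⟨hr, rfl, rfl⟩ := he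
      rw [Function.update_eq_self]
      cases hb : (c.buf i).filter (fun e => e.1 = x) with
      | nil => exact .read_from_memory c i q x d ht hb (by simpa [readVal, hb] using hr)
      | cons e w =>
        have hx : e.1 = x := by
          have : e ∈ (c.buf i).filter (fun e => e.1 = x) := by simp [hb]
          simpa using (List.mem_filter.1 this).2
        have hd : e.2 = d := by simpa [readVal, hb] using hr
        exact .read_own_write c i q x d w ht (by rw [hb, ← hx, ← hd])
    | wr x d =>
      obtain ⟨rfl, rfl⟩ := he
      exact .write c i q x d ht
    | arw x d d' =>
      obtain ⟨hb, hm, rfl, rfl⟩ := he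
      rw [Function.update_eq_self]
      exact .arw c i q x d d' ht hb hm
    | nop =>
      obtain ⟨rfl, rfl⟩ := he
      rw [Function.update_eq_self]
      exact .skip c i q ht
    | mf =>
      obtain ⟨hb, rfl, rfl⟩ := he
      rw [Function.update_eq_self]
      exact .memory_fence c i q ht hb

theorem TSOConf.update_iff {ι V D : Type} {Q : ι → Type} [DecidableEq ι] [DecidableEq V]
    {c d : TSOConf ι V D Q} :
    c.Update d ↔ ∃ i x v w, c.buf i = w ++ [(x, v)] ∧
      d = ⟨c.state, Function.update c.buf i w, Function.update c.mem x v⟩ := by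
  constructor
  · intro h
    induction h with
    | intro i x v w hw => exact ⟨i, x, v, w, hw, rfl⟩
  · rintro ⟨i, x, v, w, hw, rfl⟩
    exact .intro c i x v w hw

section

variable {ι V D : Type} {Q : ι → Type} [DecidableEq ι] [DecidableEq V]
  {P : Program ι V D Q} {F : Set (Σ i, Q i)}

theorem Program.atsoGame_move_B {c : TSOConf ι V D Q} {g : Player × TSOConf ι V D Q} :
    (P.atsoGame F).move (.B, c) g ↔ g.1 = .A ∧ P.Step c g.2 := by
  simp [atsoGame, tsoGame, Player.other]

theorem Program.atsoGame_move_A {c : TSOConf ι V D Q} {g : Player × TSOConf ι V D Q} :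
    (P.atsoGame F).move (.A, c) g ↔ g.1 = .B ∧ ∃ c₁ c₂, c.Updates c₁ ∧ P.Step c₁ c₂ ∧
      c₂.Updates g.2 := by
  have h : ∀ d d' : TSOConf ι V D Q, (d = d' ∨ d.Updates d') ↔ d.Updates d' := fun d d' =>
    ⟨fun h => h.elim (fun h => h ▸ .refl) id, .inr⟩
  simp only [atsoGame, tsoGame, Player.other, h, true_and]

end

/-! ### Configurations of the three-process program -/

namespace PCS

variable {S M : Type}

/-- The configuration with local states `a`, `b`, `r`, store buffers `b₁`, `b₂` of the first two
processes and memory `m`. The third process never writes, so its store buffer is empty. -/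
def conf (a : P1State S M) (b : P2State M) (r : P3State) (b₁ b₂ : List (PVar × PVal M))
    (m : PVar → PVal M) : TSOConf PIdx PVar (PVal M) (PState S M) where
  state
    | .p1 => a
    | .p2 => b
    | .p3 => r
  buf
    | .p1 => b₁
    | .p2 => b₂
    | .p3 => []
  mem := m

theorem step_conf_iff {L : PCS S M} {a : P1State S M} {b : P2State M} {r : P3State}
    {b₁ b₂ : List (PVar × PVal M)} {m : PVar → PVal M}
    {c : TSOConf PIdx PVar (PVal M) (PState S M)} :
    L.program.Step (conf a b r b₁ b₂ m) c ↔
      (∃ i q b' m', L.Trans1 a i q ∧ i.Eff b₁ m b' m' ∧ c = conf q b r b' b₂ m') ∨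
      (∃ i q b' m', Trans2 b i q ∧ i.Eff b₂ m b' m' ∧ c = conf a q r b₁ b' m') ∨
      (∃ q, Trans3 (M := M) r .nop q ∧ c = conf a b q b₁ b₂ m) := by
  have h1 : ∀ (q : P1State S M) (b' : List (PVar × PVal M)) (m' : PVar → PVal M),
      (⟨Function.update (conf a b r b₁ b₂ m).state .p1 q,
        Function.update (conf a b r b₁ b₂ m).buf .p1 b', m'⟩ : TSOConf _ _ _ (PState S M)) =
        conf q b r b' b₂ m' := by
    intro q b' m'
    simp only [conf, TSOConf.mk.injEq]
    refine ⟨?_, ?_, trivial⟩ <;> (funext i; cases i <;> rfl)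
  have h2 : ∀ (q : P2State M) (b' : List (PVar × PVal M)) (m' : PVar → PVal M),
      (⟨Function.update (conf a b r b₁ b₂ m).state .p2 q,
        Function.update (conf a b r b₁ b₂ m).buf .p2 b', m'⟩ : TSOConf _ _ _ (PState S M)) =
        conf a q r b₁ b' m' := by
    intro q b' m'
    simp only [conf, TSOConf.mk.injEq]
    refine ⟨?_, ?_, trivial⟩ <;> (funext i; cases i <;> rfl)
  have h3 : ∀ (q : P3State) (m' : PVar → PVal M),
      (⟨Function.update (conf a b r b₁ b₂ m).state .p3 q,
        Function.update (conf a b r b₁ b₂ m).buf .p3 [], m'⟩ : TSOConf _ _ _ (PState S M)) =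
        conf a b q b₁ b₂ m' := by
    intro q m'
    simp only [conf, TSOConf.mk.injEq]
    refine ⟨?_, ?_, trivial⟩ <;> (funext i; cases i <;> rfl)
  rw [Program.step_iff]
  constructor
  · rintro ⟨i, a', q, b', m', ht, he, rfl⟩
    cases i with
    | p1 => exact .inl ⟨a', q, b', m', ht, he, h1 q b' m'⟩
    | p2 => exact .inr (.inl ⟨a', q, b', m', ht, he, h2 q b' m'⟩)
    | p3 =>
      replace ht : Trans3 (M := M) r a' q := ht
      obtain rfl : a' = .nop := by cases ht <;> rfl
      obtain ⟨rfl, rfl⟩ := he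
      exact .inr (.inr ⟨q, ht, h3 q _⟩)
  · rintro (⟨i, q, b', m', ht, he, rfl⟩ | ⟨i, q, b', m', ht, he, rfl⟩ | ⟨q, ht, rfl⟩)
    · exact ⟨.p1, i, q, b', m', ht, he, (h1 q b' m').symm⟩
    · exact ⟨.p2, i, q, b', m', ht, he, (h2 q b' m').symm⟩
    · exact ⟨.p3, .nop, q, [], m, ht, ⟨rfl, rfl⟩, (h3 q m).symm⟩

theorem update_conf_iff {a : P1State S M} {b : P2State M} {r : P3State}
    {b₁ b₂ : List (PVar × PVal M)} {m : PVar → PVal M}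
    {c : TSOConf PIdx PVar (PVal M) (PState S M)} :
    TSOConf.Update (conf a b r b₁ b₂ m) c ↔
      (∃ w x d, b₁ = w ++ [(x, d)] ∧ c = conf a b r w b₂ (Function.update m x d)) ∨
      (∃ w x d, b₂ = w ++ [(x, d)] ∧ c = conf a b r b₁ w (Function.update m x d)) := by
  have h1 : ∀ (b' : List (PVar × PVal M)) (m' : PVar → PVal M),
      (⟨(conf a b r b₁ b₂ m).state, Function.update (conf a b r b₁ b₂ m).buf .p1 b', m'⟩ :
        TSOConf _ _ _ (PState S M)) = conf a b r b' b₂ m' := by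
    intro b' m'
    simp only [conf, TSOConf.mk.injEq]
    refine ⟨trivial, ?_, trivial⟩
    funext i; cases i <;> rfl
  have h2 : ∀ (b' : List (PVar × PVal M)) (m' : PVar → PVal M),
      (⟨(conf a b r b₁ b₂ m).state, Function.update (conf a b r b₁ b₂ m).buf .p2 b', m'⟩ :
        TSOConf _ _ _ (PState S M)) = conf a b r b₁ b' m' := by
    intro b' m'
    simp only [conf, TSOConf.mk.injEq]
    refine ⟨trivial, ?_, trivial⟩
    funext i; cases i <;> rfl
  constructor
  · intro h
    obtain ⟨i, x, d, w, hw, rfl⟩ := TSOConf.update_iff.1 h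
    cases i with
    | p1 => exact .inl ⟨w, x, d, hw, h1 _ _⟩
    | p2 => exact .inr ⟨w, x, d, hw, h2 _ _⟩
    | p3 => exact absurd (show [] = w ++ [(x, d)] from hw) (by simp)
  · rintro (⟨w, x, d, hw, rfl⟩ | ⟨w, x, d, hw, rfl⟩)
    · rw [← h1 w]
      exact .intro (conf a b r b₁ b₂ m) .p1 x d w hw
    · rw [← h2 w]
      exact .intro (conf a b r b₁ b₂ m) .p2 x d w hw

theorem programInit_eq (s₀ : S) : programInit s₀ = conf (M := M) (.chan s₀) .q1 .r1 [] []
    fun | .xwr => .bot | .xrd => .bot | .y => .zero := by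
  rw [programInit, conf, TSOConf.mk.injEq]
  exact ⟨funext fun i => by cases i <;> rfl, funext fun i => by cases i <;> rfl,
    funext fun x => by cases x <;> rfl⟩

theorem mem_final_conf {L : PCS S M} {SF : Set S} {a : P1State S M} {b : P2State M} {r : P3State}
    {b₁ b₂ : List (PVar × PVal M)} {m : PVar → PVal M} {p : Player} :
    (p, conf a b r b₁ b₂ m) ∈ (L.program.atsoGame (programFinal SF)).final ↔
      p = .A ∧ ((∃ s ∈ SF, a = .chan s) ∨ b = .qF ∨ r = .rF) := by
  simp only [Program.atsoGame, Program.tsoGame, Set.mem_ofPred_eq]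
  refine and_congr_right fun _ => ⟨?_, ?_⟩
  · rintro ⟨i, ⟨s, hs, h⟩ | h | h⟩
    · cases i <;> cases h
      exact .inl ⟨s, hs, rfl⟩
    · cases i <;> cases h
      exact .inr (.inl rfl)
    · cases i <;> cases h
      exact .inr (.inr rfl)
  · rintro (⟨s, hs, rfl⟩ | rfl | rfl)
    · exact ⟨.p1, .inl ⟨s, hs, rfl⟩⟩
    · exact ⟨.p2, .inr (.inl rfl)⟩
    · exact ⟨.p3, .inr (.inr rfl)⟩

/-- The third process can always move. -/
theorem deadlockFree (L : PCS S M) (SF : Set S) :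
    (L.program.atsoGame (programFinal SF)).DeadlockFree := by
  rintro ⟨p, c⟩
  obtain ⟨q, hq⟩ : ∃ q, Trans3 (M := M) (c.state .p3) .nop q := by
    have : ∀ r : P3State, ∃ q, Trans3 (M := M) r .nop q := by
      rintro (_ | _ | _ | _)
      exacts [⟨_, .start⟩, ⟨_, .toA⟩, ⟨_, .loopA⟩, ⟨_, .loopB⟩]
    exact this _
  exact ⟨(p.other, _), rfl, c, _, .inl rfl, .skip c .p3 q hq, .inl rfl⟩

end PCS

/-! ### Player B wins if a final channel state is reachable -/

namespace PCS

variable {S M : Type}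

/-- Player `B` can force a visit to a final configuration from the given configuration in which it
is the turn of player `p`. -/
def Forces (L : PCS S M) (SF : Set S) (p : Player) (a : P1State S M) (b : P2State M) (r : P3State)
    (b₁ b₂ : List (PVar × PVal M)) (m : PVar → PVal M) : Prop :=
  (L.program.atsoGame (programFinal SF)).Attr (p, conf a b r b₁ b₂ m)

/-- The predicate `I` on the buffers of the first two processes and the memory is preserved by
buffer updates. -/
def UpdateClosed (I : List (PVar × PVal M) → List (PVar × PVal M) → (PVar → PVal M) → Prop) :
    Prop :=
  (∀ w b₂ m x d, I (w ++ [(x, d)]) b₂ m → I w b₂ (Function.update m x d)) ∧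
  (∀ b₁ w m x d, I b₁ (w ++ [(x, d)]) m → I b₁ w (Function.update m x d))

theorem UpdateClosed.updates
    {I : List (PVar × PVal M) → List (PVar × PVal M) → (PVar → PVal M) → Prop}
    (hI : UpdateClosed I) {a : P1State S M} {b : P2State M} {r : P3State}
    {b₁ b₂ : List (PVar × PVal M)} {m : PVar → PVal M} (h : I b₁ b₂ m)
    {c : TSOConf PIdx PVar (PVal M) (PState S M)} (hc : (conf a b r b₁ b₂ m).Updates c) :
    ∃ b₁' b₂' m', I b₁' b₂' m' ∧ c = conf a b r b₁' b₂' m' := by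
  induction hc with
  | refl => exact ⟨_, _, _, h, rfl⟩
  | tail _ hu ih =>
    obtain ⟨b₁', b₂', m', hI', rfl⟩ := ih
    obtain ⟨w, x, d, rfl, rfl⟩ | ⟨w, x, d, rfl, rfl⟩ := update_conf_iff.1 hu
    · exact ⟨_, _, _, hI.1 _ _ _ _ _ hI', rfl⟩
    · exact ⟨_, _, _, hI.2 _ _ _ _ _ hI', rfl⟩

/-- Player `B` can force a win in her turn, no matter which updates player `A` does before. -/
def ForcesAfterUpdates (L : PCS S M) (SF : Set S) (a : P1State S M) (b : P2State M) (r : P3State)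
    (b₁ b₂ : List (PVar × PVal M)) (m : PVar → PVal M) : Prop :=
  ∀ b₁' b₂' m', (conf a b r b₁ b₂ m).Updates (conf a b r b₁' b₂' m') →
    L.Forces SF .B a b r b₁' b₂' m'

section

variable {L : PCS S M} {SF : Set S} {a : P1State S M} {b : P2State M} {r : P3State}
  {b₁ b₂ : List (PVar × PVal M)} {m : PVar → PVal M}

theorem ForcesAfterUpdates.of_closed
    {I : List (PVar × PVal M) → List (PVar × PVal M) → (PVar → PVal M) → Prop}
    (hI : UpdateClosed I) (h : I b₁ b₂ m)
    (hF : ∀ b₁ b₂ m, I b₁ b₂ m → L.Forces SF .B a b r b₁ b₂ m) :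
    L.ForcesAfterUpdates SF a b r b₁ b₂ m := by
  intro b₁' b₂' m' hu
  obtain ⟨b₁'', b₂'', m'', hI', h⟩ := hI.updates h hu
  rw [h] at hu
  unfold Forces
  rw [h]
  exact hF _ _ _ hI'

theorem ForcesAfterUpdates.of_forall (hF : ∀ b₁ b₂ m, L.Forces SF .B a b r b₁ b₂ m) :
    L.ForcesAfterUpdates SF a b r b₁ b₂ m :=
  fun _ _ _ _ => hF _ _ _

theorem Forces.of_step₁ {i : Instr PVar (PVal M)} {q : P1State S M} {b' : List (PVar × PVal M)}
    {m' : PVar → PVal M} (ht : L.Trans1 a i q) (he : i.Eff b₁ m b' m')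
    (h : L.Forces SF .A q b r b' b₂ m') : L.Forces SF .B a b r b₁ b₂ m :=
  .moveB _ rfl (Program.atsoGame_move_B.2
    ⟨rfl, step_conf_iff.2 (.inl ⟨i, q, b', m', ht, he, rfl⟩)⟩) h

theorem Forces.of_step₂ {i : Instr PVar (PVal M)} {q : P2State M} {b' : List (PVar × PVal M)}
    {m' : PVar → PVal M} (ht : Trans2 b i q) (he : i.Eff b₂ m b' m')
    (h : L.Forces SF .A a q r b₁ b' m') : L.Forces SF .B a b r b₁ b₂ m :=
  .moveB _ rfl (Program.atsoGame_move_B.2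
    ⟨rfl, step_conf_iff.2 (.inr (.inl ⟨i, q, b', m', ht, he, rfl⟩))⟩) h

theorem Forces.of_step₃ {q : P3State} (ht : Trans3 (M := M) r .nop q)
    (h : L.Forces SF .A a b q b₁ b₂ m) : L.Forces SF .B a b r b₁ b₂ m :=
  .moveB _ rfl (Program.atsoGame_move_B.2
    ⟨rfl, step_conf_iff.2 (.inr (.inr ⟨q, ht, rfl⟩))⟩) h

theorem forces_of_chan {s : S} (hs : s ∈ SF) : L.Forces SF .A (.chan s) b r b₁ b₂ m :=
  .final (mem_final_conf.2 ⟨rfl, .inl ⟨s, hs, rfl⟩⟩)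

theorem forces_of_qF : L.Forces SF .A a .qF r b₁ b₂ m :=
  .final (mem_final_conf.2 ⟨rfl, .inr (.inl rfl)⟩)

theorem forces_of_qF' : L.Forces SF .B a .qF .r1 b₁ b₂ m :=
  .of_step₃ .start forces_of_qF

theorem forces_of_r2 : L.Forces SF .B a b .r2 b₁ b₂ m :=
  .of_step₃ .toB (.final (mem_final_conf.2 ⟨rfl, .inr (.inr rfl)⟩))

/-- While the third process is in state `r1`, player `A` has to move one of the first two
processes in her turn: otherwise player `B` moves the third process to `rF`. -/
theorem forces_of_closed
    (I : List (PVar × PVal M) → List (PVar × PVal M) → (PVar → PVal M) → Prop)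
    (hI : UpdateClosed I) (h : I b₁ b₂ m)
    (h₁ : ∀ b₁ b₂ m i q b' m', I b₁ b₂ m → L.Trans1 a i q → i.Eff b₁ m b' m' →
      L.ForcesAfterUpdates SF q b .r1 b' b₂ m')
    (h₂ : ∀ b₁ b₂ m i q b' m', I b₁ b₂ m → Trans2 b i q → i.Eff b₂ m b' m' →
      L.ForcesAfterUpdates SF a q .r1 b₁ b' m') :
    L.Forces SF .A a b .r1 b₁ b₂ m := by
  refine .moveA rfl ?_
  rintro ⟨p, c⟩ hm
  obtain ⟨rfl, c₁, c₂, hu, hs, hu'⟩ := Program.atsoGame_move_A.1 hm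
  obtain ⟨b₁', b₂', m', hI', rfl⟩ := hI.updates h hu
  have hT : UpdateClosed (M := M) fun _ _ _ => True := by simp [UpdateClosed]
  obtain ⟨i, q, b', m'', ht, he, rfl⟩ | ⟨i, q, b', m'', ht, he, rfl⟩ | ⟨q, ht, rfl⟩ :=
    step_conf_iff.1 hs
  · obtain ⟨_, _, _, _, rfl⟩ := hT.updates trivial hu'
    exact h₁ _ _ _ _ _ _ _ hI' ht he _ _ _ hu'
  · obtain ⟨_, _, _, _, rfl⟩ := hT.updates trivial hu'
    exact h₂ _ _ _ _ _ _ _ hI' ht he _ _ _ hu'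
  · cases ht
    obtain ⟨_, _, _, _, rfl⟩ := hT.updates trivial hu'
    exact forces_of_r2

end

/-! ### Pending writes of the first process -/

/-- The store buffer of the first process if the channel contains the word `w`. -/
def enc (w : List M) : List (PVar × PVal M) :=
  w.flatMap fun m => [(.y, .one), (.xwr, .msg m)]

@[simp] theorem enc_nil : enc ([] : List M) = [] := rfl

@[simp] theorem enc_cons (m : M) (w : List M) :
    enc (m :: w) = (.y, .one) :: (.xwr, .msg m) :: enc w := rfl

theorem enc_concat (w : List M) (m : M) :
    enc (w ++ [m]) = enc w ++ [(.y, .one)] ++ [(.xwr, .msg m)] := by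
  simp [enc]

/-- The first process only writes messages to `xwr` and the value `1` to `y`. -/
def Regular (b : List (PVar × PVal M)) : Prop :=
  ∀ e ∈ b, e = (.y, .one) ∨ ∃ k, e = (.xwr, .msg k)

theorem regular_nil : Regular ([] : List (PVar × PVal M)) := by simp [Regular]

theorem regular_cons {e : PVar × PVal M} {b : List (PVar × PVal M)} :
    Regular (e :: b) ↔ (e = (.y, .one) ∨ ∃ k, e = (.xwr, .msg k)) ∧ Regular b := by
  simp [Regular]

theorem regular_concat {e : PVar × PVal M} {b : List (PVar × PVal M)} :
    Regular (b ++ [e]) ↔ Regular b ∧ (e = (.y, .one) ∨ ∃ k, e = (.xwr, .msg k)) := by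
  simp [Regular, or_imp, forall_and]

theorem regular_enc (w : List M) : Regular (enc w) := by
  induction w with
  | nil => exact regular_nil
  | cons m w ih => simp [regular_cons, ih]

theorem readVal_xrd_of_regular {b : List (PVar × PVal M)} (h : Regular b) (m : PVar → PVal M) :
    readVal b m .xrd = m .xrd := by
  have : b.filter (fun e => e.1 = .xrd) = [] := by
    rw [List.filter_eq_nil_iff]
    intro e he
    obtain rfl | ⟨k, rfl⟩ := h e he <;> simp
  simp [readVal, this]

@[simp] theorem readVal_nil (m : PVar → PVal M) (x : PVar) : readVal [] m x = m x := rfl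

/-- The first process keeps its store buffer regular and does not write directly to the memory. -/
theorem Trans1.regular {L : PCS S M} {a q : P1State S M} {i : Instr PVar (PVal M)}
    (ht : L.Trans1 a i q) {b b' : List (PVar × PVal M)} {m m' : PVar → PVal M}
    (he : i.Eff b m b' m') (hb : Regular b) : Regular b' ∧ m' = m := by
  cases ht <;> simp only [Instr.Eff] at he
  case send_start => exact ⟨he.1 ▸ by simp [regular_cons, hb], he.2⟩
  case send_end => exact ⟨he.1 ▸ by simp [regular_cons, hb], he.2⟩
  case skip_start => exact ⟨he.1 ▸ hb, he.2⟩
  case skip_end => exact ⟨he.1 ▸ hb, he.2⟩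
  case recv_start => exact ⟨he.1 ▸ hb, he.2⟩
  case recv_end => exact ⟨he.1 ▸ hb, he.2⟩
  case recv_empty' => exact ⟨he.1 ▸ hb, he.2⟩
  all_goals exact ⟨he.2.1 ▸ hb, he.2.2⟩

/-- The sequence `u` of writes starts with a message for `xwr`, followed by a write to `y`, if any
(the last list entries are the oldest writes). -/
def StartsWithMessage (u : List (PVar × PVal M)) : Prop :=
  ∀ u' e, u = u' ++ [e] → (∃ k, e = (.xwr, .msg k)) ∧ ∀ u'' e', u' = u'' ++ [e'] → e' = (.y, .one)

theorem startsWithMessage_enc (w : List M) : StartsWithMessage (enc w) := by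
  induction w using List.reverseRecOn with
  | nil => simp [StartsWithMessage]
  | append_singleton w m _ =>
    intro u' e h
    rw [enc_concat, List.append_singleton_inj] at h
    obtain ⟨rfl, rfl⟩ := h
    refine ⟨⟨m, rfl⟩, fun u'' e' h => ?_⟩
    rw [List.append_singleton_inj] at h
    exact h.2.symm

theorem startsWithMessage_cons_enc (m : M) (w : List M) :
    StartsWithMessage ((.xwr, .msg m) :: enc w) := by
  induction w using List.reverseRecOn with
  | nil =>
    intro u' e h
    rw [enc_nil, ← List.nil_append [_], List.append_singleton_inj] at h
    obtain ⟨rfl, rfl⟩ := h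
    simp
  | append_singleton w k _ =>
    intro u' e h
    rw [enc_concat, ← List.cons_append, ← List.cons_append, List.append_singleton_inj] at h
    obtain ⟨rfl, rfl⟩ := h
    refine ⟨⟨k, rfl⟩, fun u'' e' h => ?_⟩
    rw [List.append_singleton_inj] at h
    exact h.2.symm

/-- How much of the pending writes `u` player `A` has moved to the memory while the second process
is in state `q1`, starting from `xwr ↦ ⊥` and `y ↦ 0`: nothing, the oldest message only, or more. -/
def Drained (u b : List (PVar × PVal M)) (m : PVar → PVal M) : Prop :=
  Regular b ∧ ((b = u ∧ m .xwr = .bot ∧ m .y = .zero) ∨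
    (∃ k, u = b ++ [(.xwr, .msg k)] ∧ m .xwr = .msg k ∧ m .y = .zero) ∨
    ((∃ k, m .xwr = .msg k) ∧ m .y = .one))

theorem Drained.update {u w : List (PVar × PVal M)} {m : PVar → PVal M} {x : PVar} {d : PVal M}
    (hu : StartsWithMessage u) (h : Drained u (w ++ [(x, d)]) m) :
    Drained u w (Function.update m x d) := by
  obtain ⟨hr, h⟩ := h
  obtain ⟨hr, hxd⟩ := regular_concat.1 hr
  refine ⟨hr, ?_⟩
  obtain ⟨rfl, hx, hy⟩ | ⟨k, rfl, hx, hy⟩ | ⟨⟨k, hx⟩, hy⟩ := h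
  · obtain ⟨⟨k, hk⟩, -⟩ := hu _ _ rfl
    cases hk
    exact .inr (.inl ⟨k, rfl, by simp, by simp [hy]⟩)
  · have := (hu _ _ rfl).2 _ _ rfl
    cases this
    exact .inr (.inr ⟨⟨k, by simp [hx]⟩, by simp⟩)
  · refine .inr (.inr ?_)
    obtain h | ⟨k', h⟩ := hxd <;> cases h
    · exact ⟨⟨k, by simp [hx]⟩, by simp⟩
    · exact ⟨⟨k', by simp⟩, by simp [hy]⟩

theorem Drained.append {u b l : List (PVar × PVal M)} {m : PVar → PVal M} (h : Drained u b m)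
    (hl : Regular l) : Drained (l ++ u) (l ++ b) m := by
  obtain ⟨hr, h⟩ := h
  refine ⟨fun e he => (List.mem_append.1 he).elim (hl e) (hr e), ?_⟩
  obtain ⟨rfl, h⟩ | ⟨k, rfl, h⟩ | h := h
  · exact .inl ⟨rfl, h⟩
  · exact .inr (.inl ⟨k, by simp, h⟩)
  · exact .inr (.inr h)

/-- Like `Drained`, but while the second process is in state `q3`, after it has fetched the oldest
message of `u`. -/
def Fetched (u b₁ b₂ : List (PVar × PVal M)) (m : PVar → PVal M) : Prop :=
  Regular b₁ ∧ (∀ e ∈ b₂, e.1 = .xrd) ∧ (m .y = .one ∨ (m .y = .zero ∧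
    ∃ k, u = b₁ ++ [(.xwr, .msg k)] ∧
      ((b₂ = [(.xrd, .msg k)] ∧ m .xrd = .bot) ∨ (b₂ = [] ∧ m .xrd = .msg k))))

theorem Fetched.append {u b₁ b₂ l : List (PVar × PVal M)} {m : PVar → PVal M}
    (h : Fetched u b₁ b₂ m) (hl : Regular l) : Fetched (l ++ u) (l ++ b₁) b₂ m := by
  obtain ⟨hr, hb, h⟩ := h
  refine ⟨fun e he => (List.mem_append.1 he).elim (hl e) (hr e), hb, ?_⟩
  obtain h | ⟨hy, k, rfl, h⟩ := h
  · exact .inl h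
  · exact .inr ⟨hy, k, by simp, h⟩

theorem append_singleton_eq_singleton {α : Type} {w : List α} {a b : α} :
    w ++ [a] = [b] ↔ w = [] ∧ a = b := by
  rw [← List.nil_append [b], List.append_singleton_inj]

theorem updateClosed_fetched {u : List (PVar × PVal M)} (hu : StartsWithMessage u) :
    UpdateClosed (Fetched u) := by
  refine ⟨?_, ?_⟩
  · rintro w b₂ m x d ⟨hr, hb, h⟩
    obtain ⟨hr, hxd⟩ := regular_concat.1 hr
    refine ⟨hr, hb, .inl ?_⟩
    obtain hy | ⟨hy, k, rfl, h⟩ := h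
    · obtain h | ⟨k, h⟩ := hxd <;> cases h <;> simp [hy]
    · have := (hu _ _ rfl).2 _ _ rfl
      cases this
      simp
  · rintro b₁ w m x d ⟨hr, hb, h⟩
    obtain rfl : x = .xrd := hb (x, d) (by simp)
    refine ⟨hr, fun e he => hb e (by simp [he]), ?_⟩
    obtain hy | ⟨hy, k, rfl, h | h⟩ := h
    · exact .inl (by simp [hy])
    · obtain ⟨rfl, h⟩ := append_singleton_eq_singleton.1 h.1
      obtain rfl : d = .msg k := by simpa using h.1
      exact .inr ⟨by simp [hy], k, rfl, .inr ⟨rfl, by simp⟩⟩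
    · simp at h

end PCS

namespace PCS

variable {S M : Type} {L : PCS S M} {SF : Set S}

/-! ### Mistakes of player A -/

section

variable {a : P1State S M} {b₁ b₂ : List (PVar × PVal M)} {m : PVar → PVal M}

theorem forces_q4 : L.Forces SF .B a .q4 .r1 b₁ b₂ m :=
  .of_step₂ .final4 ⟨rfl, rfl⟩ forces_of_qF

/-- The second process punishes a message that is left in `xwr` while it is in state `q1`. -/
theorem forces_q1_of_msg {r : P3State} {k : M} (h : m .xwr = .msg k) :
    L.Forces SF .B a .q1 r b₁ [] m :=
  .of_step₂ (.final1 k) ⟨h, rfl, rfl⟩ forces_of_qF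

theorem forces_q9_of_msg {r : P3State} {k : M} (h : m .xwr = .msg k) :
    L.Forces SF .B a .q9 r b₁ [] m :=
  .of_step₂ (.final9 k) ⟨h, rfl, rfl⟩ forces_of_qF

theorem forces_q5_of_one {r : P3State} (h : m .y = .one) :
    L.Forces SF .B a .q5 r b₁ [] m :=
  .of_step₂ .final5 ⟨h, rfl, rfl⟩ forces_of_qF

/-- The second process punishes the value `1` in `y` while it is in state `q3`. -/
theorem forces_q3_of_one {r : P3State} (hb : ∀ e ∈ b₂, e.1 = PVar.xrd) (h : m .y = .one) :
    L.Forces SF .B a .q3 r b₁ b₂ m := by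
  refine .of_step₂ .final3 ⟨?_, rfl, rfl⟩ forces_of_qF
  have : b₂.filter (fun e => e.1 = .y) = [] := by
    rw [List.filter_eq_nil_iff]
    intro e he
    simp [hb e he]
  simp [readVal, this, h]

/-- Once player `A` has moved a `1` to `y` while the second process is in state `q3`, she cannot
undo this. -/
theorem forcesAfterUpdates_q3_of_one (hr : Regular b₁) (hb : ∀ e ∈ b₂, e.1 = PVar.xrd)
    (h : m .y = .one) : L.ForcesAfterUpdates SF a .q3 .r1 b₁ b₂ m := by
  refine .of_closed
    (I := fun b₁ b₂ m => Regular b₁ ∧ (∀ e ∈ b₂, e.1 = PVar.xrd) ∧ m .y = .one)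
    ⟨?_, ?_⟩ ⟨hr, hb, h⟩ fun b₁ b₂ m ⟨_, hb, h⟩ => forces_q3_of_one hb h
  · rintro w b₂ m x d ⟨hr, hb, h⟩
    obtain ⟨hr, hxd⟩ := regular_concat.1 hr
    refine ⟨hr, hb, ?_⟩
    obtain h | ⟨k, h⟩ := hxd <;> cases h <;> simp [h]
  · rintro b₁ w m x d ⟨hr, hb, h⟩
    obtain rfl : x = .xrd := hb (x, d) (by simp)
    exact ⟨hr, fun e he => hb e (by simp [he]), by simp [h]⟩

/-- In state `q3`, a move of the second process by player `A` loses. -/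
theorem forcesAfterUpdates_of_q3 {i : Instr PVar (PVal M)} {q : P2State M} (h : Trans2 .q3 i q) :
    L.ForcesAfterUpdates SF a q .r1 b₁ b₂ m := by
  cases h with
  | t3 => exact .of_forall fun _ _ _ => forces_q4
  | final3 => exact .of_forall fun _ _ _ => forces_of_qF'

end

/-! ### Simulation of skip and send transitions -/

/-- Player `B` wins if it is her turn and the channel system is in the configuration `(s, w)`; the
oldest message of `w` may already have been fetched by the second process. -/
def ForcesConf (L : PCS S M) (SF : Set S) (s : S) (w : List M) : Prop :=
  (∀ m : PVar → PVal M, m .xwr = .bot → m .xrd = .bot → m .y = .zero →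
    L.Forces SF .B (.chan s) .q1 .r1 (enc w) [] m) ∧
  (∀ b₁ b₂ m, Fetched (enc w) b₁ b₂ m → L.Forces SF .B (.chan s) .q3 .r1 b₁ b₂ m)

/-- The only transition from the state `h` of the first process leads to the channel state `s` and
performs the writes `l` (at most one). -/
def Finishes (L : PCS S M) (h : P1State S M) (l : List (PVar × PVal M)) (s : S) : Prop :=
  ∀ i q, L.Trans1 h i q → q = .chan s ∧ ((i = .nop ∧ l = []) ∨ (i = .wr .y .one ∧ l = [(.y, .one)]))

section

variable {h : P1State S M} {l u : List (PVar × PVal M)} {s : S} {w : List M}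
  {b₁ b₂ : List (PVar × PVal M)} {m : PVar → PVal M}

theorem Finishes.regular (hf : L.Finishes h l s) {i : Instr PVar (PVal M)} {q : P1State S M}
    (ht : L.Trans1 h i q) : Regular l := by
  obtain ⟨-, ⟨-, rfl⟩ | ⟨-, rfl⟩⟩ := hf i q ht <;> simp [Regular]

theorem Finishes.eff (hf : L.Finishes h l s) {i : Instr PVar (PVal M)} {q : P1State S M}
    (ht : L.Trans1 h i q) {b' : List (PVar × PVal M)} {m' : PVar → PVal M}
    (he : i.Eff b₁ m b' m') : q = .chan s ∧ b' = l ++ b₁ ∧ m' = m := by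
  obtain ⟨rfl, ⟨rfl, rfl⟩ | ⟨rfl, rfl⟩⟩ := hf i q ht <;> exact ⟨rfl, he⟩

theorem Finishes.forces_q3 (hf : L.Finishes h l s) (H : L.ForcesConf SF s w) (hw : enc w = l ++ u)
    (hu : StartsWithMessage u) (hI : Fetched u b₁ b₂ m) :
    L.Forces SF .A h .q3 .r1 b₁ b₂ m := by
  refine forces_of_closed _ (updateClosed_fetched hu) hI ?_ fun _ _ _ _ _ _ _ _ ht _ =>
    forcesAfterUpdates_of_q3 ht
  intro b₁ b₂ m i q b' m' hI ht he
  obtain ⟨rfl, rfl, rfl⟩ := hf.eff ht he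
  exact .of_closed (updateClosed_fetched (startsWithMessage_enc w))
    (hw ▸ hI.append (hf.regular ht)) H.2

theorem updateClosed_drained (hu : StartsWithMessage u) :
    UpdateClosed fun b₁ b₂ m => Drained u b₁ m ∧ b₂ = [] ∧ m .xrd = .bot := by
  refine ⟨?_, by simp⟩
  rintro w b₂ m x d ⟨hd, rfl, hx⟩
  refine ⟨hd.update hu, rfl, ?_⟩
  obtain h | ⟨k, h⟩ := (regular_concat.1 hd.1).2 <;> cases h <;> simp [hx]

/-- If player `A` makes the second process read a message `k`, then `k` is the oldest one or the
value `1` has reached `y`. Player `B` answers by moving the second process to `q3`. -/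
theorem forcesAfterUpdates_qmsg {k : M} {a : P1State S M} (hu : StartsWithMessage u)
    (hd : Drained u b₁ m) (hm : m .xwr = .msg k) (hx : m .xrd = .bot)
    (hF : ∀ b₁ b₂ m, Fetched u b₁ b₂ m → L.Forces SF .A a .q3 .r1 b₁ b₂ m) :
    L.ForcesAfterUpdates SF a (.qmsg k) .r1 b₁ [] m := by
  refine .of_closed (I := fun b₁ b₂ m => Regular b₁ ∧ b₂ = [] ∧ m .xrd = .bot ∧
    (m .y = .one ∨ (m .y = .zero ∧ u = b₁ ++ [(.xwr, .msg k)]))) ⟨?_, by simp⟩ ?_ ?_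
  · rintro w b₂ m x d ⟨hr, rfl, hx, h⟩
    obtain ⟨hr, hxd⟩ := regular_concat.1 hr
    refine ⟨hr, rfl, ?_, .inl ?_⟩
    · obtain h | ⟨k, h⟩ := hxd <;> cases h <;> simp [hx]
    · obtain hy | ⟨hy, rfl⟩ := h
      · obtain h | ⟨k, h⟩ := hxd <;> cases h <;> simp [hy]
      · have := (hu _ _ rfl).2 _ _ rfl
        cases this
        simp
  · refine ⟨hd.1, rfl, hx, ?_⟩
    obtain ⟨_, hx, _⟩ | ⟨k', rfl, hx, hy⟩ | ⟨_, hy⟩ := hd.2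
    · simp [hm] at hx
    · rw [hm] at hx
      cases hx
      exact .inr ⟨hy, rfl⟩
    · exact .inl hy
  · rintro b₁ b₂ m ⟨hr, rfl, hx, h⟩
    refine .of_step₂ (.write_msg k) ⟨rfl, rfl⟩ (hF _ _ _ ⟨hr, by simp, ?_⟩)
    exact h.imp id fun h => ⟨h.1, k, h.2, .inl ⟨rfl, hx⟩⟩

theorem Finishes.forces_q1 (hf : L.Finishes h l s) (H : L.ForcesConf SF s w) (hw : enc w = l ++ u)
    (hu : StartsWithMessage u) (hd : Drained u b₁ m) (hx : m .xrd = .bot) :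
    L.Forces SF .A h .q1 .r1 b₁ [] m := by
  refine forces_of_closed _ (updateClosed_drained hu) ⟨hd, rfl, hx⟩ ?_ ?_
  · rintro b₁ b₂ m i q b' m' ⟨hd, rfl, hx⟩ ht he
    obtain ⟨rfl, rfl, rfl⟩ := hf.eff ht he
    refine .of_closed (updateClosed_drained (startsWithMessage_enc w))
      ⟨hw ▸ hd.append (hf.regular ht), rfl, hx⟩ ?_
    rintro b₁ b₂ m ⟨⟨_, ⟨rfl, hm, hy⟩ | ⟨k, _, hm, _⟩ | ⟨⟨k, hm⟩, _⟩⟩, rfl, hx⟩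
    · exact H.1 m hm hx hy
    · exact forces_q1_of_msg hm
    · exact forces_q1_of_msg hm
  · rintro b₁ b₂ m i q b' m' ⟨hd, rfl, hx⟩ ht he
    cases ht with
    | read_msg k =>
      obtain ⟨hm, rfl, rfl⟩ := he
      exact forcesAfterUpdates_qmsg hu hd hm hx fun _ _ _ => hf.forces_q3 H hw hu
    | final1 => exact .of_forall fun _ _ _ => forces_of_qF'

theorem drained_self (hr : Regular u) (h₁ : m .xwr = .bot) (h₂ : m .y = .zero) :
    Drained u u m :=
  ⟨hr, .inl ⟨rfl, h₁, h₂⟩⟩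

end

theorem forcesConf_of_skip {s s' : S} {w : List M} (ht : L.trans s .nop s')
    (H : L.ForcesConf SF s' w) : L.ForcesConf SF s w := by
  have hf : L.Finishes (.aux s .nop s' .h1) [] s' := by
    intro i q h
    cases h
    exact ⟨rfl, .inl ⟨rfl, rfl⟩⟩
  refine ⟨fun m h₁ h₂ h₃ => ?_, fun b₁ b₂ m hI => ?_⟩
  · exact .of_step₁ (.skip_start s s' ht) ⟨rfl, rfl⟩ (hf.forces_q1 H rfl
      (startsWithMessage_enc w) (drained_self (regular_enc w) h₁ h₃) h₂)
  · exact .of_step₁ (.skip_start s s' ht) ⟨rfl, rfl⟩ (hf.forces_q3 H rfl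
      (startsWithMessage_enc w) hI)

theorem forcesConf_of_send {s s' : S} {k : M} {w : List M} (ht : L.trans s (.send k) s')
    (H : L.ForcesConf SF s' (k :: w)) : L.ForcesConf SF s w := by
  have hf : L.Finishes (.aux s (.send k) s' .h1) [(.y, .one)] s' := by
    intro i q h
    cases h
    exact ⟨rfl, .inr ⟨rfl, rfl⟩⟩
  have hr : Regular [((.xwr : PVar), PVal.msg k)] := by simp [Regular]
  refine ⟨fun m h₁ h₂ h₃ => ?_, fun b₁ b₂ m hI => ?_⟩
  · exact .of_step₁ (.send_start s s' k ht) ⟨rfl, rfl⟩ (hf.forces_q1 H rfl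
      (startsWithMessage_cons_enc k w)
      ((drained_self (regular_enc w) h₁ h₃).append hr) h₂)
  · exact .of_step₁ (.send_start s s' k ht) ⟨rfl, rfl⟩ (hf.forces_q3 H rfl
      (startsWithMessage_cons_enc k w) (hI.append hr))

end PCS

namespace PCS

variable {S M : Type} {L : PCS S M} {SF : Set S}

/-! ### Simulation of receive transitions -/

theorem Regular.update_xrd {w : List (PVar × PVal M)} {x : PVar} {d : PVal M}
    (h : Regular (w ++ [(x, d)])) (m : PVar → PVal M) : Function.update m x d .xrd = m .xrd := by
  obtain h | ⟨k, h⟩ := (regular_concat.1 h).2 <;> cases h <;> simp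

/-- A message that player `A` moves to `xwr` stays there until `xwr` is overwritten by another
message. -/
theorem Regular.update_xwr {w : List (PVar × PVal M)} {x : PVar} {d : PVal M}
    (h : Regular (w ++ [(x, d)])) {m : PVar → PVal M} (hm : ∃ k, m .xwr = .msg k) :
    ∃ k, Function.update m x d .xwr = .msg k := by
  obtain h | ⟨k, h⟩ := (regular_concat.1 h).2 <;> cases h
  · simpa using hm
  · exact ⟨k, by simp⟩

theorem Regular.update_y {w : List (PVar × PVal M)} {x : PVar} {d : PVal M}
    (h : Regular (w ++ [(x, d)])) {m : PVar → PVal M} (hm : m .y = .one) :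
    Function.update m x d .y = .one := by
  obtain h | ⟨k, h⟩ := (regular_concat.1 h).2 <;> cases h <;> simp [hm]

theorem update_xwr_of_eq_enc {w : List (PVar × PVal M)} {x : PVar} {d : PVal M} {v : List M}
    (h : w ++ [(x, d)] = enc v) (m : PVar → PVal M) :
    ∃ k, Function.update m x d .xwr = .msg k := by
  obtain ⟨⟨k, hk⟩, -⟩ := startsWithMessage_enc v _ _ h.symm
  cases hk
  exact ⟨k, by simp⟩

section

variable {s s' : S} {k : M} {w : List M} {b₁ b₂ : List (PVar × PVal M)} {m : PVar → PVal M}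

/-- After the message has been read, the first process waits until `xrd` is reset to `⊥`. -/
theorem trans1_h2 {i : Instr PVar (PVal M)} {q : P1State S M}
    (h : L.Trans1 (.aux s (.recv k) s' .h2) i q) :
    i = .rd .xrd .bot ∧ q = .aux s (.recv k) s' .h3 := by
  cases h
  exact ⟨rfl, rfl⟩

theorem not_eff_h2 {i : Instr PVar (PVal M)} {q : P1State S M}
    (h : L.Trans1 (.aux s (.recv k) s' .h2) i q) (hr : Regular b₁) (hm : ∃ k, m .xrd = .msg k)
    {b' : List (PVar × PVal M)} {m' : PVar → PVal M} : ¬ i.Eff b₁ m b' m' := by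
  obtain ⟨rfl, -⟩ := trans1_h2 h
  rintro ⟨he, -⟩
  obtain ⟨k, hk⟩ := hm
  rw [readVal_xrd_of_regular hr, hk] at he
  cases he

theorem finishes_h3 : L.Finishes (.aux s (.recv k) s' .h3) [] s' := by
  intro i q h
  cases h
  exact ⟨rfl, .inl ⟨rfl, rfl⟩⟩

theorem forces_h2_q10 (ht : L.trans s (.recv k) s') (H : L.ForcesConf SF s' w)
    (hd : Drained (enc w) b₁ m) (hx : ∃ k, m .xrd = .msg k) :
    L.Forces SF .A (.aux s (.recv k) s' .h2) .q10 .r1 b₁ [(.xrd, .bot)] m := by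
  have hu := startsWithMessage_enc w
  refine forces_of_closed (fun b₁ b₂ m => Drained (enc w) b₁ m ∧
    ((b₂ = [(.xrd, .bot)] ∧ ∃ k, m .xrd = .msg k) ∨ (b₂ = [] ∧ m .xrd = .bot)))
    ⟨?_, ?_⟩ ⟨hd, .inl ⟨rfl, hx⟩⟩ ?_ ?_
  · rintro w b₂ m x d ⟨hd, h⟩
    refine ⟨hd.update hu, ?_⟩
    rwa [hd.1.update_xrd]
  · rintro b₁ w m x d ⟨hd, ⟨h, -⟩ | ⟨h, -⟩⟩
    · obtain ⟨rfl, h⟩ := append_singleton_eq_singleton.1 h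
      cases h
      exact ⟨by simpa [Drained] using hd, .inr ⟨rfl, by simp⟩⟩
    · simp at h
  · rintro b₁ b₂ m i q b' m' ⟨hd, ⟨-, hx⟩ | ⟨rfl, hx⟩⟩ ht he
    · exact absurd he (not_eff_h2 ht hd.1 hx)
    · obtain ⟨rfl, rfl⟩ := trans1_h2 ht
      obtain ⟨-, rfl, rfl⟩ := he
      refine .of_closed (updateClosed_drained hu) ⟨hd, rfl, hx⟩ ?_
      rintro b₁ b₂ m ⟨hd, rfl, hx⟩
      exact .of_step₂ .t10 ⟨rfl, rfl, rfl⟩ (finishes_h3.forces_q1 H rfl hu hd hx)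
  · rintro b₁ b₂ m i q b' m' ⟨hd, h⟩ ht₂ he
    cases ht₂
    obtain ⟨rfl, rfl, rfl⟩ := he
    replace hx : m' .xrd = .bot := by simpa using h
    refine .of_closed (updateClosed_drained hu) ⟨hd, rfl, hx⟩ ?_
    rintro b₁ b₂ m ⟨hd, rfl, hx⟩
    obtain ⟨rfl, h₁, h₂⟩ | ⟨k, _, hm, _⟩ | ⟨⟨k, hm⟩, _⟩ := hd.2
    · exact .of_step₁ (.recv_reset s s' k ht)
        ⟨by rw [readVal_xrd_of_regular hd.1, hx], rfl, rfl⟩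
        (finishes_h3.forces_q1 H rfl hu hd hx)
    · exact forces_q1_of_msg hm
    · exact forces_q1_of_msg hm

theorem forces_h2_q8 (ht : L.trans s (.recv k) s') (H : L.ForcesConf SF s' w)
    (hr : Regular b₁) (hx : ∃ k, m .xrd = .msg k)
    (h : (b₁ = enc w ∧ m .xwr = .bot) ∨ ∃ k, m .xwr = .msg k) :
    L.Forces SF .A (.aux s (.recv k) s' .h2) .q8 .r1 b₁ [(.y, .zero)] m := by
  refine forces_of_closed (fun b₁ b₂ m => Regular b₁ ∧ (∃ k, m .xrd = .msg k) ∧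
    (b₂ = [(.y, .zero)] ∨ b₂ = []) ∧
    ((b₁ = enc w ∧ m .xwr = .bot ∧ (b₂ = [] → m .y = .zero)) ∨ ∃ k, m .xwr = .msg k))
    ⟨?_, ?_⟩ ⟨hr, hx, .inl rfl, h.imp (by simp) id⟩ ?_ ?_
  · rintro w b₂ m x d ⟨hr, hx, hb, h⟩
    refine ⟨(regular_concat.1 hr).1, by rwa [hr.update_xrd], hb, .inr ?_⟩
    obtain ⟨h, -⟩ | h := h
    · exact update_xwr_of_eq_enc h m
    · exact hr.update_xwr h
  · rintro b₁ w m x d ⟨hr, hx, hb | hb, h⟩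
    · obtain ⟨rfl, hxd⟩ := append_singleton_eq_singleton.1 hb
      cases hxd
      refine ⟨hr, by simpa using hx, .inr rfl, ?_⟩
      simpa using h.imp (fun h => ⟨h.1, h.2.1⟩) id
    · simp at hb
  · rintro b₁ b₂ m i q b' m' ⟨hr, hx, -⟩ ht he
    exact absurd he (not_eff_h2 ht hr hx)
  · rintro b₁ b₂ m i q b' m' ⟨hr, hx, -, h⟩ ht₂ he
    cases ht₂
    obtain ⟨rfl, rfl, rfl⟩ := he
    refine .of_closed (I := fun b₁ b₂ m => Regular b₁ ∧ (∃ k, m .xrd = .msg k) ∧ b₂ = [] ∧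
      ((b₁ = enc w ∧ m .xwr = .bot ∧ m .y = .zero) ∨ ∃ k, m .xwr = .msg k)) ⟨?_, by simp⟩
      ⟨hr, hx, rfl, by simpa using h⟩ ?_
    · rintro w b₂ m x d ⟨hr, hx, rfl, h⟩
      refine ⟨(regular_concat.1 hr).1, by rwa [hr.update_xrd], rfl, .inr ?_⟩
      obtain ⟨h, -⟩ | h := h
      · exact update_xwr_of_eq_enc h m
      · exact hr.update_xwr h
    · rintro b₁ b₂ m ⟨hr, hx, rfl, ⟨rfl, h₁, h₂⟩ | ⟨k, h⟩⟩
      · exact .of_step₂ .t9 ⟨rfl, rfl⟩ (forces_h2_q10 ht H (drained_self hr h₁ h₂) hx)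
      · exact forces_q9_of_msg h

theorem forces_h2_q6 (ht : L.trans s (.recv k) s') (H : L.ForcesConf SF s' w)
    (hr : Regular b₁) (hx : ∃ k, m .xrd = .msg k)
    (hb : b₁ = enc w ++ [(.y, .one)]) (h₁ : m .xwr = .bot) (h₂ : m .y = .zero) :
    L.Forces SF .A (.aux s (.recv k) s' .h2) .q6 .r1 b₁ [] m := by
  refine forces_of_closed (fun b₁ b₂ m => Regular b₁ ∧ (∃ k, m .xrd = .msg k) ∧ b₂ = [] ∧
    ((b₁ = enc w ++ [(.y, .one)] ∧ m .xwr = .bot ∧ m .y = .zero) ∨ (b₁ = enc w ∧ m .xwr = .bot) ∨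
      ∃ k, m .xwr = .msg k)) ⟨?_, by simp⟩ ⟨hr, hx, rfl, .inl ⟨hb, h₁, h₂⟩⟩ ?_ ?_
  · rintro w b₂ m x d ⟨hr, hx, rfl, h⟩
    refine ⟨(regular_concat.1 hr).1, by rwa [hr.update_xrd], rfl, .inr ?_⟩
    obtain ⟨h, h₁, -⟩ | ⟨h, -⟩ | h := h
    · obtain ⟨rfl, hxd⟩ := List.append_singleton_inj.1 h
      cases hxd
      exact .inl ⟨rfl, by simpa using h₁⟩
    · exact .inr (update_xwr_of_eq_enc h m)
    · exact .inr (hr.update_xwr h)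
  · rintro b₁ b₂ m i q b' m' ⟨hr, hx, -⟩ ht he
    exact absurd he (not_eff_h2 ht hr hx)
  · rintro b₁ b₂ m i q b' m' ⟨hr, hx, rfl, h⟩ ht₂ he
    cases ht₂
    obtain ⟨hy, rfl, rfl⟩ := he
    rw [readVal_nil] at hy
    refine .of_closed (I := fun b₁ b₂ m => Regular b₁ ∧ (∃ k, m .xrd = .msg k) ∧ b₂ = [] ∧
      ((b₁ = enc w ∧ m .xwr = .bot) ∨ ∃ k, m .xwr = .msg k)) ⟨?_, by simp⟩
      ⟨hr, hx, rfl, by simpa [hy] using h⟩ ?_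
    · rintro w b₂ m x d ⟨hr, hx, rfl, h⟩
      refine ⟨(regular_concat.1 hr).1, by rwa [hr.update_xrd], rfl, .inr ?_⟩
      obtain ⟨h, -⟩ | h := h
      · exact update_xwr_of_eq_enc h m
      · exact hr.update_xwr h
    · rintro b₁ b₂ m ⟨hr, hx, rfl, h⟩
      exact .of_step₂ .t7 ⟨rfl, rfl⟩ (forces_h2_q8 ht H hr hx h)

/-- Player `B` lets the second process overwrite `xwr`. Player `A` then has to execute the fence, and
moving a `1` to `y` before that is punished in state `q5`. -/
theorem forces_h2_q3 (ht : L.trans s (.recv k) s') (H : L.ForcesConf SF s' w)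
    (hr : Regular b₁) (hx : ∃ k, m .xrd = .msg k)
    (h : (b₁ = enc w ++ [(.y, .one)] ∧ m .y = .zero) ∨ m .y = .one) :
    L.Forces SF .B (.aux s (.recv k) s' .h2) .q3 .r1 b₁ [] m := by
  refine .of_step₂ .t3 ⟨rfl, rfl⟩ ?_
  refine forces_of_closed (fun b₁ b₂ m => Regular b₁ ∧ (∃ k, m .xrd = .msg k) ∧
    (b₂ = [(.xwr, .bot)] ∨ b₂ = []) ∧
    ((b₁ = enc w ++ [(.y, .one)] ∧ m .y = .zero ∧ (b₂ = [] → m .xwr = .bot)) ∨ m .y = .one))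
    ⟨?_, ?_⟩ ⟨hr, hx, .inl rfl, h.imp (by simp) id⟩ ?_ ?_
  · rintro w b₂ m x d ⟨hr, hx, hb, h⟩
    refine ⟨(regular_concat.1 hr).1, by rwa [hr.update_xrd], hb, .inr ?_⟩
    obtain ⟨h, -⟩ | h := h
    · obtain ⟨rfl, hxd⟩ := List.append_singleton_inj.1 h
      cases hxd
      simp
    · exact hr.update_y h
  · rintro b₁ w m x d ⟨hr, hx, hb | hb, h⟩
    · obtain ⟨rfl, hxd⟩ := append_singleton_eq_singleton.1 hb
      cases hxd
      refine ⟨hr, by simpa using hx, .inr rfl, ?_⟩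
      simpa using h.imp (fun h => ⟨h.1, h.2.1⟩) id
    · simp at hb
  · exact fun _ _ _ _ _ _ _ _ _ _ => .of_forall fun _ _ _ => forces_q4
  · rintro b₁ b₂ m i q b' m' ⟨hr, hx, -, h⟩ ht₂ he
    cases ht₂ with
    | t4 =>
      obtain ⟨rfl, rfl, rfl⟩ := he
      refine .of_closed (I := fun b₁ b₂ m => Regular b₁ ∧ (∃ k, m .xrd = .msg k) ∧ b₂ = [] ∧
        ((b₁ = enc w ++ [(.y, .one)] ∧ m .y = .zero ∧ m .xwr = .bot) ∨ m .y = .one)) ⟨?_, by simp⟩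
        ⟨hr, hx, rfl, by simpa using h⟩ ?_
      · rintro w b₂ m x d ⟨hr, hx, rfl, h⟩
        refine ⟨(regular_concat.1 hr).1, by rwa [hr.update_xrd], rfl, .inr ?_⟩
        obtain ⟨h, -⟩ | h := h
        · obtain ⟨rfl, hxd⟩ := List.append_singleton_inj.1 h
          cases hxd
          simp
        · exact hr.update_y h
      · rintro b₁ b₂ m ⟨hr, hx, rfl, ⟨hb, h₁, h₂⟩ | h⟩
        · exact .of_step₂ .t5 ⟨rfl, rfl⟩ (forces_h2_q6 ht H hr hx hb h₂ h₁)
        · exact forces_q5_of_one h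
    | final4 => exact .of_forall fun _ _ _ => forces_of_qF'

theorem forces_h1_q3 (ht : L.trans s (.recv k) s') (H : L.ForcesConf SF s' w)
    (hF : Fetched (enc (w ++ [k])) b₁ b₂ m) :
    L.Forces SF .A (.aux s (.recv k) s' .h1) .q3 .r1 b₁ b₂ m := by
  refine forces_of_closed _ (updateClosed_fetched (startsWithMessage_enc _)) hF ?_
    fun _ _ _ _ _ _ _ _ ht _ => forcesAfterUpdates_of_q3 ht
  rintro b₁ b₂ m i q b' m' ⟨hr, hb, hy | ⟨hy, k', hu, h⟩⟩ ht₁ he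
  · obtain ⟨hr', rfl⟩ := ht₁.regular he hr
    exact forcesAfterUpdates_q3_of_one hr' hb hy
  · rw [enc_concat, List.append_singleton_inj] at hu
    obtain ⟨hu, hk⟩ := hu
    cases hk
    cases ht₁ with
    | recv_read _ _ _ _ =>
      obtain ⟨hx, rfl, rfl⟩ := he
      rw [readVal_xrd_of_regular hr] at hx
      obtain rfl : b₂ = [] := by
        obtain ⟨-, h⟩ | h := h
        · simp [h] at hx
        · exact h.1
      refine .of_closed (I := fun b₁ b₂ m => Regular b₁ ∧ (∃ k, m .xrd = .msg k) ∧ b₂ = [] ∧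
        ((b₁ = enc w ++ [(.y, .one)] ∧ m .y = .zero) ∨ m .y = .one)) ⟨?_, by simp⟩
        ⟨hr, ⟨k, hx⟩, rfl, .inl ⟨hu.symm, hy⟩⟩ ?_
      · rintro w b₂ m x d ⟨hr, hx, rfl, h⟩
        refine ⟨(regular_concat.1 hr).1, by rwa [hr.update_xrd], rfl, .inr ?_⟩
        obtain ⟨h, -⟩ | h := h
        · obtain ⟨rfl, hxd⟩ := List.append_singleton_inj.1 h
          cases hxd
          simp
        · exact hr.update_y h
      · rintro b₁ b₂ m ⟨hr, hx, rfl, h⟩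
        exact forces_h2_q3 ht H hr hx h
    | recv_empty _ _ _ _ =>
      rw [he.1] at hu
      simp at hu
    | recv_wrong _ _ _ k' _ hk =>
      obtain ⟨hx, -⟩ := he
      rw [readVal_xrd_of_regular hr] at hx
      obtain ⟨-, h⟩ | ⟨-, h⟩ := h <;> rw [h] at hx <;> cases hx
      exact absurd rfl hk

theorem forcesConf_of_recv (ht : L.trans s (.recv k) s') (H : L.ForcesConf SF s' w) :
    L.ForcesConf SF s (w ++ [k]) := by
  have hu := startsWithMessage_enc (w ++ [k])
  refine ⟨fun m h₁ h₂ h₃ => ?_, fun b₁ b₂ m hF => ?_⟩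
  · refine .of_step₁ (.recv_start s s' k ht) ⟨rfl, rfl⟩ ?_
    refine forces_of_closed _ (updateClosed_drained hu)
      ⟨drained_self (regular_enc _) h₁ h₃, rfl, h₂⟩ ?_ ?_
    · rintro b₁ b₂ m i q b' m' ⟨hd, rfl, hx⟩ ht₁ he
      cases ht₁ with
      | recv_read _ _ _ _ =>
        obtain ⟨he, -⟩ := he
        rw [readVal_xrd_of_regular hd.1, hx] at he
        cases he
      | recv_wrong _ _ _ k' _ _ =>
        obtain ⟨he, -⟩ := he
        rw [readVal_xrd_of_regular hd.1, hx] at he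
        cases he
      | recv_empty _ _ _ _ =>
        -- The fence forces player `A` to move all messages to the memory.
        obtain ⟨rfl, rfl, rfl⟩ := he
        have hm : ∃ k, m' .xwr = .msg k := by
          obtain ⟨h, -⟩ | ⟨k', -, hm, -⟩ | ⟨hm, -⟩ := hd.2
          · simp [enc_concat] at h
          · exact ⟨k', hm⟩
          · exact hm
        refine .of_closed (I := fun b₁ b₂ m => Regular b₁ ∧ b₂ = [] ∧ ∃ k, m .xwr = .msg k)
          ⟨?_, by simp⟩ ⟨regular_nil, rfl, hm⟩ ?_
        · rintro w b₂ m x d ⟨hr, rfl, h⟩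
          exact ⟨(regular_concat.1 hr).1, rfl, hr.update_xwr h⟩
        · rintro b₁ b₂ m ⟨-, rfl, k, h⟩
          exact forces_q1_of_msg h
    · rintro b₁ b₂ m i q b' m' ⟨hd, rfl, hx⟩ ht₂ he
      cases ht₂ with
      | read_msg k =>
        obtain ⟨hm, rfl, rfl⟩ := he
        exact forcesAfterUpdates_qmsg hu hd hm hx fun _ _ _ => forces_h1_q3 ht H
      | final1 => exact .of_forall fun _ _ _ => forces_of_qF'
  · exact .of_step₁ (.recv_start s s' k ht) ⟨rfl, rfl⟩ (forces_h1_q3 ht H hF)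

end

theorem forcesConf_of_reachable {s s' : S} {w w' : List M} (hs : s' ∈ SF)
    (h : Relation.ReflTransGen L.Step (s, w) (s', w')) : L.ForcesConf SF s w := by
  suffices H : ∀ c, Relation.ReflTransGen L.Step c (s', w') → L.ForcesConf SF c.1 c.2 from H _ h
  intro c hc
  induction hc using Relation.ReflTransGen.head_induction_on with
  | refl =>
    exact ⟨fun _ _ _ _ => .of_step₃ .start (forces_of_chan hs),
      fun _ _ _ _ => .of_step₃ .start (forces_of_chan hs)⟩
  | head hstep _ ih =>
    cases hstep with
    | send s s' k w ht => exact forcesConf_of_send ht ih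
    | recv s s' k w ht => exact forcesConf_of_recv ht ih
    | skip s s' w ht => exact forcesConf_of_skip ht ih

end PCS

namespace PCS

variable {S M : Type}

/-! ### Player A wins if no final channel state is reachable -/

theorem updates_buf₁ {a : P1State S M} {b : P2State M} {r : P3State}
    {w b₂ : List (PVar × PVal M)} {m : PVar → PVal M} {x : PVar} {d : PVal M} :
    (conf a b r (w ++ [(x, d)]) b₂ m).Updates (conf a b r w b₂ (Function.update m x d)) :=
  .single (update_conf_iff.2 (.inl ⟨w, x, d, rfl, rfl⟩))

theorem updates_buf₂ {a : P1State S M} {b : P2State M} {r : P3State}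
    {b₁ : List (PVar × PVal M)} {m : PVar → PVal M} {x : PVar} {d : PVal M} :
    (conf a b r b₁ [(x, d)] m).Updates (conf a b r b₁ [] (Function.update m x d)) :=
  .single (update_conf_iff.2 (.inr ⟨[], x, d, rfl, rfl⟩))

/-- States of the first process in which it waits for `xrd` to be reset, when the remaining channel
word is `w`: either the expected message was read, or a wrong message was read (then `h6` is a
dead end). -/
inductive Waiting (L : PCS S M) (R : Set (S × List M)) : P1State S M → List M → Prop
  | read (s s' : S) (k : M) (w : List M) : L.trans s (.recv k) s' → (s', w) ∈ R →
      Waiting L R (.aux s (.recv k) s' .h2) w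
  | stuck (s s' : S) (k : M) (w : List M) : Waiting L R (.aux s (.recv k) s' .h6) w

/-- The local states and buffers of the first two processes and the memory in the turns of player
`B`, if player `A` updates buffers as late as possible and answers every move in the process where
it happened or, if a receive transition starts, by fetching the oldest message. `R` is the set of
reachable channel configurations. -/
inductive SafeAt (L : PCS S M) (R : Set (S × List M)) :
    P1State S M → P2State M → List (PVar × PVal M) → List (PVar × PVal M) → (PVar → PVal M) → Prop
  | idle (s : S) (w : List M) (m) : (s, w) ∈ R → m .xwr = .bot → m .xrd = .bot → m .y = .zero →
      SafeAt L R (.chan s) .q1 (enc w) [] m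
  | empty (s s' : S) (k : M) (m) : L.trans s (.recv k) s' → m .xwr = .bot → m .xrd = .bot →
      m .y = .zero → SafeAt L R (.aux s (.recv k) s' .h4) .q1 [] [] m
  | fetched (s s' : S) (k k' : M) (w : List M) (m) : L.trans s (.recv k) s' →
      (s, w ++ [k']) ∈ R → m .xwr = .msg k' → m .xrd = .bot → m .y = .zero →
      SafeAt L R (.aux s (.recv k) s' .h1) (.qmsg k') (enc w ++ [(.y, .one)]) [] m
  | read (a) (k : M) (w : List M) (m) : Waiting L R a w → m .xrd = .msg k → m .y = .zero →
      SafeAt L R a .q3 (enc w ++ [(.y, .one)]) [] m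
  | cleared (a) (k : M) (w : List M) (m) : Waiting L R a w → m .xwr = .bot → m .xrd = .msg k →
      m .y = .zero → SafeAt L R a .q5 (enc w ++ [(.y, .one)]) [] m
  | marked (a) (k : M) (w : List M) (m) : Waiting L R a w → m .xwr = .bot → m .xrd = .msg k →
      SafeAt L R a .q7 (enc w) [] m
  | unmarked (a) (k : M) (w : List M) (m) : Waiting L R a w → m .xwr = .bot → m .xrd = .msg k →
      m .y = .zero → SafeAt L R a .q9 (enc w) [] m
  | reset (a) (w : List M) (m) : Waiting L R a w → m .xwr = .bot → m .xrd = .bot →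
      m .y = .zero → SafeAt L R a .q1 (enc w) [] m

/-- The safe configurations of player `B`. -/
def safeB (L : PCS S M) (R : Set (S × List M)) :
    Set (Player × TSOConf PIdx PVar (PVal M) (PState S M)) :=
  {g | ∃ a b r b₁ b₂ m, g = (.B, conf a b r b₁ b₂ m) ∧ (r = .r1 ∨ r = .r3) ∧
    SafeAt L R a b b₁ b₂ m}

/-- The safe configurations of player `A`: those that are not final and from which she can move to a
safe configuration of player `B`. -/
def safeA (L : PCS S M) (SF : Set S) (R : Set (S × List M)) :
    Set (Player × TSOConf PIdx PVar (PVal M) (PState S M)) :=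
  {g | g.1 = .A ∧ g ∉ (L.program.atsoGame (programFinal SF)).final ∧
    ∃ d ∈ safeB L R, (L.program.atsoGame (programFinal SF)).move g d}

section

variable {L : PCS S M} {SF : Set S} {R : Set (S × List M)} {a : P1State S M} {b : P2State M}
  {r : P3State} {b₁ b₂ : List (PVar × PVal M)} {m : PVar → PVal M}

theorem safeA_of_step₁ {b₁' b₂' b' : List (PVar × PVal M)} {m' m'' : PVar → PVal M}
    {i : Instr PVar (PVal M)} {q : P1State S M}
    (ha : ∀ s ∈ SF, a ≠ .chan s) (hb : b ≠ .qF) (hr : r = .r1 ∨ r = .r3)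
    (hu : (conf a b r b₁ b₂ m).Updates (conf a b r b₁' b₂' m'))
    (ht : L.Trans1 a i q) (he : i.Eff b₁' m' b' m'') (h : SafeAt L R q b b' b₂' m'') :
    (.A, conf a b r b₁ b₂ m) ∈ safeA L SF R := by
  refine ⟨rfl, ?_, (.B, _), ⟨q, b, r, b', b₂', m'', rfl, hr, h⟩,
    Program.atsoGame_move_A.2 ⟨rfl, _, _, hu, step_conf_iff.2 (.inl ⟨i, q, b', m'', ht, he, rfl⟩),
      .refl⟩⟩
  rw [mem_final_conf]
  rintro ⟨-, ⟨s, hs, rfl⟩ | rfl | rfl⟩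
  · exact ha s hs rfl
  · exact hb rfl
  · simp at hr

theorem safeA_of_step₂ {b₁' b₂' b' : List (PVar × PVal M)} {m' m'' : PVar → PVal M}
    {i : Instr PVar (PVal M)} {q : P2State M}
    (ha : ∀ s ∈ SF, a ≠ .chan s) (hb : b ≠ .qF) (hr : r = .r1 ∨ r = .r3)
    (hu : (conf a b r b₁ b₂ m).Updates (conf a b r b₁' b₂' m'))
    (ht : Trans2 b i q) (he : i.Eff b₂' m' b' m'') (h : SafeAt L R a q b₁' b' m'') :
    (.A, conf a b r b₁ b₂ m) ∈ safeA L SF R := by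
  refine ⟨rfl, ?_, (.B, _), ⟨a, q, r, b₁', b', m'', rfl, hr, h⟩,
    Program.atsoGame_move_A.2 ⟨rfl, _, _, hu,
      step_conf_iff.2 (.inr (.inl ⟨i, q, b', m'', ht, he, rfl⟩)), .refl⟩⟩
  rw [mem_final_conf]
  rintro ⟨-, ⟨s, hs, rfl⟩ | rfl | rfl⟩
  · exact ha s hs rfl
  · exact hb rfl
  · simp at hr

theorem safeA_of_step₃ {q : P3State} (ha : ∀ s ∈ SF, a ≠ .chan s) (hb : b ≠ .qF)
    (hr : r ≠ .rF) (hq : q = .r1 ∨ q = .r3) (ht : Trans3 (M := M) r .nop q)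
    (h : SafeAt L R a b b₁ b₂ m) : (.A, conf a b r b₁ b₂ m) ∈ safeA L SF R := by
  refine ⟨rfl, ?_, (.B, _), ⟨a, b, q, b₁, b₂, m, rfl, hq, h⟩,
    Program.atsoGame_move_A.2 ⟨rfl, _, _, .refl, step_conf_iff.2 (.inr (.inr ⟨q, ht, rfl⟩)),
      .refl⟩⟩
  rw [mem_final_conf]
  rintro ⟨-, ⟨s, hs, rfl⟩ | rfl | rfl⟩
  · exact ha s hs rfl
  · exact hb rfl
  · exact hr rfl

theorem Waiting.ne_chan {w : List M} (h : Waiting L R a w) (s : S) : a ≠ .chan s := by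
  cases h <;> simp

/-- A waiting process is blocked until `xrd` is reset. -/
theorem Waiting.not_eff {k : M} {w : List M} (h : Waiting L R a w)
    {i : Instr PVar (PVal M)} {q : P1State S M} (ht : L.Trans1 a i q) (hr : Regular b₁)
    (hx : m .xrd = .msg k) {b' : List (PVar × PVal M)} {m' : PVar → PVal M} :
    ¬ i.Eff b₁ m b' m' := by
  cases h with
  | read => exact not_eff_h2 ht hr ⟨k, hx⟩
  | stuck => cases ht

theorem regular_enc_concat (w : List M) : Regular (enc w ++ [((.y : PVar), (.one : PVal M))]) :=
  regular_concat.2 ⟨regular_enc w, .inl rfl⟩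

theorem SafeAt.ne_qF (h : SafeAt L R a b b₁ b₂ m) : b ≠ .qF := by
  cases h <;> simp

theorem SafeAt.ne_chan (hSF : ∀ c ∈ R, c.1 ∉ SF) (h : SafeAt L R a b b₁ b₂ m) :
    ∀ s ∈ SF, a ≠ .chan s := by
  rintro s hs rfl
  cases h with
  | idle _ w _ hR => exact hSF _ hR hs
  | _ => exact absurd rfl (Waiting.ne_chan ‹_› s)

theorem SafeAt.step₁ (hR : ∀ c ∈ R, ∀ d, L.Step c d → d ∈ R) (h : SafeAt L R a b b₁ b₂ m)
    (hr : r = .r1 ∨ r = .r3) {i : Instr PVar (PVal M)} {q : P1State S M} (ht : L.Trans1 a i q)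
    {b' : List (PVar × PVal M)} {m' : PVar → PVal M} (he : i.Eff b₁ m b' m') :
    (.A, conf q b r b' b₂ m') ∈ safeA L SF R := by
  cases h with
  | idle s w _ hsw h₁ h₂ h₃ =>
    cases ht with
    | skip_start _ s' ht =>
      obtain ⟨rfl, rfl⟩ := he
      exact safeA_of_step₁ (by simp) (by simp) hr .refl (.skip_end s s' ht) ⟨rfl, rfl⟩
        (.idle _ _ _ (hR _ hsw _ (.skip _ _ _ ht)) h₁ h₂ h₃)
    | send_start _ s' k ht =>
      obtain ⟨rfl, rfl⟩ := he
      exact safeA_of_step₁ (by simp) (by simp) hr .refl (.send_end s s' k ht) ⟨rfl, rfl⟩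
        (.idle _ _ _ (hR _ hsw _ (.send _ _ _ _ ht)) h₁ h₂ h₃)
    | recv_start _ s' k ht =>
      obtain ⟨rfl, rfl⟩ := he
      induction w using List.reverseRecOn with
      | nil =>
        exact safeA_of_step₁ (by simp) (by simp) hr .refl (.recv_empty s s' k ht) ⟨rfl, rfl, rfl⟩
          (.empty _ _ _ _ ht h₁ h₂ h₃)
      | append_singleton w k' _ =>
        rw [enc_concat]
        refine safeA_of_step₂ (by simp) (by simp) hr updates_buf₁ (.read_msg k') ⟨?_, rfl, rfl⟩
          (.fetched _ _ _ _ _ _ ht hsw ?_ ?_ ?_) <;> simp [h₂, h₃]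
  | empty s s' k _ ht h₁ h₂ h₃ =>
    cases ht
    obtain ⟨rfl, rfl⟩ := he
    exact safeA_of_step₁ (by simp) (by simp) hr .refl (.recv_empty'' _ _ _ ‹_›) ⟨h₁, rfl, rfl⟩
      (.reset _ [] _ (.stuck _ _ _ _) h₁ h₂ h₃)
  | fetched s s' k k' w _ ht hsw h₁ h₂ h₃ =>
    -- The first process can neither read a message nor execute the fence.
    cases ht with
    | recv_read =>
      have := he.1
      rw [readVal_xrd_of_regular (regular_enc_concat w), h₂] at this
      cases this
    | recv_empty => simpa using he.1
    | recv_wrong =>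
      have := he.1
      rw [readVal_xrd_of_regular (regular_enc_concat w), h₂] at this
      cases this
  | read _ k w _ hw h₂ h₃ => exact absurd he (hw.not_eff ht (regular_enc_concat w) h₂)
  | cleared _ k w _ hw h₁ h₂ h₃ => exact absurd he (hw.not_eff ht (regular_enc_concat w) h₂)
  | marked _ k w _ hw h₁ h₂ => exact absurd he (hw.not_eff ht (regular_enc w) h₂)
  | unmarked _ k w _ hw h₁ h₂ h₃ => exact absurd he (hw.not_eff ht (regular_enc w) h₂)
  | reset _ w _ hw h₁ h₂ h₃ =>
    cases hw with
    | stuck => cases ht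
    | read s s' k _ htr hsw =>
      obtain ⟨rfl, rfl⟩ := trans1_h2 ht
      obtain ⟨-, rfl, rfl⟩ := he
      exact safeA_of_step₁ (by simp) (by simp) hr .refl (.recv_end s s' k htr) ⟨rfl, rfl⟩
        (.idle _ _ _ hsw h₁ h₂ h₃)

theorem SafeAt.step₂ (hR : ∀ c ∈ R, ∀ d, L.Step c d → d ∈ R) (h : SafeAt L R a b b₁ b₂ m)
    (hr : r = .r1 ∨ r = .r3) {i : Instr PVar (PVal M)} {q : P2State M} (ht : Trans2 b i q)
    {b' : List (PVar × PVal M)} {m' : PVar → PVal M} (he : i.Eff b₂ m b' m') :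
    (.A, conf a q r b₁ b' m') ∈ safeA L SF R := by
  -- The second process cannot read a message or the value `1` when it should not.
  have hq1 : b = .q1 → b₂ = [] → m .xwr = .bot → False := by
    rintro rfl rfl h
    cases ht <;> (have := he.1; simp [h] at this)
  cases h with
  | idle s w _ hsw h₁ h₂ h₃ => exact (hq1 rfl rfl h₁).elim
  | empty s s' k _ _ h₁ h₂ h₃ => exact (hq1 rfl rfl h₁).elim
  | reset _ w _ hw h₁ h₂ h₃ => exact (hq1 rfl rfl h₁).elim
  | fetched s s' k k' w _ htr hsw h₁ h₂ h₃ =>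
    cases ht
    obtain ⟨rfl, rfl⟩ := he
    have hx : readVal (enc w ++ [(.y, .one)]) (Function.update m' .xrd (PVal.msg k')) .xrd
        = .msg k' := by
      rw [readVal_xrd_of_regular (regular_enc_concat w)]
      simp
    by_cases hk : k' = k
    · subst hk
      refine safeA_of_step₁ (by simp) (by simp) hr updates_buf₂ (.recv_read s s' k' htr)
        ⟨hx, rfl, rfl⟩ (.read _ k' _ _ (.read _ _ _ _ htr (hR _ hsw _ (.recv _ _ _ _ htr))) ?_ ?_)
        <;> simp [h₃]
    · refine safeA_of_step₁ (by simp) (by simp) hr updates_buf₂ (.recv_wrong s s' k k' htr hk)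
        ⟨hx, rfl, rfl⟩ (.read _ k' _ _ (.stuck _ _ _ _) ?_ ?_) <;> simp [h₃]
  | read _ k w _ hw h₂ h₃ =>
    cases ht with
    | t3 =>
      obtain ⟨rfl, rfl⟩ := he
      refine safeA_of_step₂ (fun s _ => hw.ne_chan s) (by simp) hr updates_buf₂ .t4 ⟨rfl, rfl, rfl⟩
        (.cleared _ k _ _ hw ?_ ?_ ?_) <;> simp [h₂, h₃]
    | final3 =>
      have := he.1
      simp [h₃] at this
  | cleared _ k w _ hw h₁ h₂ h₃ =>
    cases ht with
    | t5 =>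
      obtain ⟨rfl, rfl⟩ := he
      refine safeA_of_step₂ (fun s _ => hw.ne_chan s) (by simp) hr updates_buf₁ .t6 ⟨?_, rfl, rfl⟩
        (.marked _ k _ _ hw ?_ ?_) <;> simp [h₁, h₂]
    | final5 =>
      have := he.1
      simp [h₃] at this
  | marked _ k w _ hw h₁ h₂ =>
    cases ht
    obtain ⟨rfl, rfl⟩ := he
    refine safeA_of_step₂ (fun s _ => hw.ne_chan s) (by simp) hr updates_buf₂ .t8 ⟨rfl, rfl, rfl⟩
      (.unmarked _ k _ _ hw ?_ ?_ ?_) <;> simp [h₁, h₂]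
  | unmarked _ k w _ hw h₁ h₂ h₃ =>
    cases ht with
    | t9 =>
      obtain ⟨rfl, rfl⟩ := he
      refine safeA_of_step₂ (fun s _ => hw.ne_chan s) (by simp) hr updates_buf₂ .t10
        ⟨rfl, rfl, rfl⟩ (.reset _ _ _ hw ?_ ?_ ?_) <;> simp [h₁, h₃]
    | final9 =>
      have := he.1
      simp [h₁] at this

theorem isSafe (hR : ∀ c ∈ R, ∀ d, L.Step c d → d ∈ R) (hSF : ∀ c ∈ R, c.1 ∉ SF) :
    (L.program.atsoGame (programFinal SF)).IsSafe (safeB L R ∪ safeA L SF R) where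
  not_final := by
    rintro _ (⟨a, b, r, b₁, b₂, m, rfl, -⟩ | h)
    · simp [mem_final_conf]
    · exact h.2.1
  forall_move := by
    rintro _ (⟨a, b, r, b₁, b₂, m, rfl, hr, h⟩ | h) ho ⟨p, c⟩ hm
    · obtain ⟨rfl, hs⟩ := Program.atsoGame_move_B.1 hm
      obtain ⟨i, q, b', m', ht, he, rfl⟩ | ⟨i, q, b', m', ht, he, rfl⟩ | ⟨q, ht, rfl⟩ :=
        step_conf_iff.1 hs
      · exact .inr (h.step₁ hR hr ht he)
      · exact .inr (h.step₂ hR hr ht he)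
      · obtain rfl | rfl := hr <;> cases ht
        · exact .inr (safeA_of_step₃ (h.ne_chan hSF) h.ne_qF (by simp) (.inr rfl) .toA h)
        · exact .inr (safeA_of_step₃ (h.ne_chan hSF) h.ne_qF (by simp) (.inr rfl) .loopA h)
    · exact absurd (h.1.symm.trans ho) (by simp)
  exists_move := by
    rintro _ (⟨a, b, r, b₁, b₂, m, rfl, -⟩ | h) ho
    · exact absurd ho (by simp [Program.atsoGame, Program.tsoGame])
    · obtain ⟨-, -, d, hd, hm⟩ := h
      exact ⟨d, hm, .inl hd⟩

end

/-! ### Channel systems and their games -/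

/-- The configuration of the program that corresponds to the configuration `(s, w)` of the channel
system. -/
def startConf (s : S) (w : List M) : TSOConf PIdx PVar (PVal M) (PState S M) :=
  conf (.chan s) .q1 .r1 (enc w) [] fun | .xwr => .bot | .xrd => .bot | .y => .zero

theorem attr_startConf {L : PCS S M} {SF : Set S} {s : S} {w : List M}
    (h : ∃ s' ∈ SF, L.StateReachable (s, w) s') :
    (L.program.atsoGame (programFinal SF)).Attr (.B, startConf s w) := by
  obtain ⟨s', hs', w', h⟩ := h
  exact (forcesConf_of_reachable hs' h).1 _ rfl rfl rfl

theorem isSafe_startConf {L : PCS S M} {SF : Set S} {s : S} {w : List M}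
    (h : ¬ ∃ s' ∈ SF, L.StateReachable (s, w) s') :
    ∃ X, (L.program.atsoGame (programFinal SF)).IsSafe X ∧ (.B, startConf s w) ∈ X := by
  refine ⟨_, isSafe (R := {c | Relation.ReflTransGen L.Step (s, w) c})
    (fun c hc d hd => hc.tail hd) (fun c hc hs => h ⟨c.1, hs, c.2, hc⟩),
    .inl ⟨_, _, _, _, _, _, rfl, .inl rfl, .idle s w _ .refl rfl rfl rfl⟩⟩

theorem reachable_iff_winsB (L : PCS S M) (s₀ : S) (SF : Set S) :
    (∃ s ∈ SF, L.StateReachable (s₀, []) s) ↔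
      (L.program.atsoGame (programFinal SF)).WinsB (Player.B, programInit s₀) := by
  rw [show programInit s₀ = startConf (M := M) s₀ [] from programInit_eq s₀]
  refine ⟨fun h => (attr_startConf h).winsB (deadlockFree L SF), fun h => ?_⟩
  by_contra hn
  obtain ⟨X, hX, hc⟩ := isSafe_startConf hn
  exact (hX.winsA (deadlockFree L SF) hc).not_winsB h

end PCS

/-! ### Channel systems simulate stack machines -/

namespace StackQueue

open Turing

/-- Messages of the channel system that simulates a machine with stacks `K` and stack alphabet `Γ`:
stack symbols and markers for the top and the bottom of the stacks. -/
inductive Sym (K Γ : Type)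
  | top (k : K)
  | sym (g : Γ)
  | bot

/-- States of the channel system. In `run q v` the statement `q` is to be executed, and the internal
state of the machine is `v`. In `emit₁` and `emit₂` one or two messages have to be sent before. In
`look q v k` the marker `top k` has been received in order to inspect the stack `k`. -/
inductive State (K Γ T σ : Type)
  | run (q : T) (v : σ)
  | emit₁ (q : T) (v : σ) (c : Sym K Γ)
  | emit₂ (q : T) (v : σ) (c c' : Sym K Γ)
  | look (q : T) (v : σ) (k : K)

variable {K Γ Λ σ : Type}

/-- The statements of a machine with labels `A` and their substatements. -/
abbrev Stmts (N : Λ → TM2.Stmt (fun _ : K => Γ) Λ σ) (A : Finset Λ) : Type :=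
  {q : TM2.Stmt (fun _ : K => Γ) Λ σ // some q ∈ TM2.stmts N A}

instance finite_stmts (N : Λ → TM2.Stmt (fun _ : K => Γ) Λ σ) (A : Finset Λ) :
    Finite (Stmts N A) := by
  have : Finite {q // q ∈ TM2.stmts N A} := inferInstance
  exact Finite.of_injective (fun q : Stmts N A => (⟨some q.1, q.2⟩ : {q // q ∈ TM2.stmts N A}))
    fun q q' h => Subtype.ext (Option.some_injective _ (congrArg Subtype.val h))

instance [Finite K] [Finite Γ] : Finite (Sym K Γ) := by
  refine Finite.of_injective (β := K ⊕ Γ ⊕ Unit)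
    (fun | .top k => .inl k | .sym g => .inr (.inl g) | .bot => .inr (.inr ())) ?_
  rintro (_ | _ | _) (_ | _ | _) h <;> simp_all

instance {T : Type} [Finite K] [Finite Γ] [Finite T] [Finite σ] : Finite (State K Γ T σ) := by
  refine Finite.of_injective
    (β := (T × σ) ⊕ (T × σ × Sym K Γ) ⊕ (T × σ × Sym K Γ × Sym K Γ) ⊕ (T × σ × K))
    (fun
      | .run q v => .inl (q, v)
      | .emit₁ q v c => .inr (.inl (q, v, c))
      | .emit₂ q v c c' => .inr (.inr (.inl (q, v, c, c')))
      | .look q v k => .inr (.inr (.inr (q, v, k)))) ?_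
  rintro (_ | _ | _ | _) (_ | _ | _ | _) h <;> simp_all

/-- Transitions of the channel system that simulates the stack machine `N`. The channel contains
the stacks one after the other, each of them between its two markers, up to rotation. -/
inductive Trans (N : Λ → TM2.Stmt (fun _ : K => Γ) Λ σ) (A : Finset Λ) :
    State K Γ (Stmts N A) σ → ChanOp (Sym K Γ) → State K Γ (Stmts N A) σ → Prop
  | rotate (q v c) : Trans N A (.run q v) (.recv c) (.emit₁ q v c)
  | emit₁ (q v c) : Trans N A (.emit₁ q v c) (.send c) (.run q v)
  | emit₂ (q v c c') : Trans N A (.emit₂ q v c c') (.send c) (.emit₁ q v c')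
  | push (q q' : Stmts N A) (v k f) : q.1 = .push k f q'.1 →
      Trans N A (.run q v) (.recv (.top k)) (.emit₂ q' v (.top k) (.sym (f v)))
  | pop (q q' : Stmts N A) (v k f) : q.1 = .pop k f q'.1 →
      Trans N A (.run q v) (.recv (.top k)) (.look q v k)
  | pop_sym (q q' : Stmts N A) (v k f g) : q.1 = .pop k f q'.1 →
      Trans N A (.look q v k) (.recv (.sym g)) (.emit₁ q' (f v (some g)) (.top k))
  | pop_bot (q q' : Stmts N A) (v k f) : q.1 = .pop k f q'.1 →
      Trans N A (.look q v k) (.recv .bot) (.emit₂ q' (f v none) (.top k) .bot)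
  | peek (q q' : Stmts N A) (v k f) : q.1 = .peek k f q'.1 →
      Trans N A (.run q v) (.recv (.top k)) (.look q v k)
  | peek_sym (q q' : Stmts N A) (v k f g) : q.1 = .peek k f q'.1 →
      Trans N A (.look q v k) (.recv (.sym g)) (.emit₂ q' (f v (some g)) (.top k) (.sym g))
  | peek_bot (q q' : Stmts N A) (v k f) : q.1 = .peek k f q'.1 →
      Trans N A (.look q v k) (.recv .bot) (.emit₂ q' (f v none) (.top k) .bot)
  | load (q q' : Stmts N A) (v f) : q.1 = .load f q'.1 →
      Trans N A (.run q v) .nop (.run q' (f v))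
  | branch_true (q q' : Stmts N A) (v f q₂) : q.1 = .branch f q'.1 q₂ → f v = true →
      Trans N A (.run q v) .nop (.run q' v)
  | branch_false (q q' : Stmts N A) (v f q₁) : q.1 = .branch f q₁ q'.1 → f v = false →
      Trans N A (.run q v) .nop (.run q' v)
  | goto (q q' : Stmts N A) (v l) : q.1 = .goto l → q'.1 = N (l v) →
      Trans N A (.run q v) .nop (.run q' v)

/-- The channel system that simulates the stack machine `N`. -/
def system (N : Λ → TM2.Stmt (fun _ : K => Γ) Λ σ) (A : Finset Λ) :
    PCS (State K Γ (Stmts N A) σ) (Sym K Γ) where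
  trans := Trans N A

/-- The states in which the simulated machine halts. -/
def haltStates (N : Λ → TM2.Stmt (fun _ : K => Γ) Λ σ) (A : Finset Λ) :
    Set (State K Γ (Stmts N A) σ) :=
  {s | ∃ q v, s = .run q v ∧ q.1 = .halt}

/-- A stack between its markers, in the order of the channel: the oldest message is the marker of
the top. -/
def block (k : K) (l : List Γ) : List (Sym K Γ) :=
  .bot :: l.reverse.map .sym ++ [.top k]

/-- The channel word of the stacks `S`, where `ks` lists the names of the stacks. -/
def word (ks : List K) (S : K → List Γ) : List (Sym K Γ) :=
  ks.flatMap fun k => block k (S k)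

theorem top_mem_block {k k' : K} {l : List Γ} : Sym.top k ∈ block k' l ↔ k = k' := by
  simp [block]

theorem word_split [DecidableEq K] {ks : List K} (hks : ks.Nodup) {k : K} (hk : k ∈ ks)
    (S : K → List Γ) :
    ∃ t, Sym.top k ∉ t ∧ ∀ l, word ks (Function.update S k l) ~r t ++ block k l := by
  obtain ⟨ks₁, ks₂, rfl⟩ := List.append_of_mem hk
  simp only [List.nodup_append, List.nodup_cons, List.mem_cons, ne_eq] at hks
  have h₁ : k ∉ ks₁ := fun h => hks.2.2 k h k (.inl rfl) rfl
  have h₂ : k ∉ ks₂ := hks.2.1.1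
  have hw : ∀ ks : List K, k ∉ ks → Sym.top k ∉ word ks S ∧
      ∀ l, word ks (Function.update S k l) = word ks S := by
    intro ks hk
    refine ⟨?_, fun l => ?_⟩
    · simp only [word, List.mem_flatMap, top_mem_block, not_exists, not_and]
      rintro k' hk' rfl
      exact hk hk'
    · refine List.flatMap_congr fun k' hk' => ?_
      rw [Function.update_of_ne]
      rintro rfl
      exact hk hk'
  refine ⟨word ks₂ S ++ word ks₁ S, ?_, fun l => ?_⟩
  · simp [(hw _ h₁).1, (hw _ h₂).1]
  · have : word (ks₁ ++ k :: ks₂) (Function.update S k l) =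
        (word ks₁ S ++ block k l) ++ word ks₂ S := by
      rw [← (hw _ h₁).2 l, ← (hw _ h₂).2 l]
      simp [word]
    rw [this, List.append_assoc (word ks₂ S)]
    exact List.isRotated_append

theorem isRotated_iff_append {α : Type} {u v : List α} :
    u ~r v ↔ ∃ x y, u = x ++ y ∧ v = y ++ x := by
  constructor
  · rintro ⟨n, rfl⟩
    refine ⟨u.take (n % u.length), u.drop (n % u.length), by simp, ?_⟩
    rw [List.rotate_eq_drop_append_take_mod]
  · rintro ⟨x, y, rfl, rfl⟩
    exact List.isRotated_append

/-- Two rotations of a word that end with the same symbol agree if the symbol occurs only once. -/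
theorem eq_of_isRotated_concat {α : Type} {u v : List α} {a : α} (h : u ++ [a] ~r v ++ [a])
    (ha : a ∉ v) : u = v := by
  obtain ⟨x, y, hu, hv⟩ := isRotated_iff_append.1 h
  induction x using List.reverseRecOn with
  | nil =>
    rw [List.nil_append] at hu
    rw [List.append_nil, ← hu, List.append_singleton_inj] at hv
    exact hv.1.symm
  | append_singleton x b _ =>
    rw [← List.append_assoc, List.append_singleton_inj] at hv
    induction y using List.reverseRecOn with
    | nil =>
      rw [List.append_nil, List.append_singleton_inj] at hu
      rw [hu.1, hv.1, List.nil_append]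
    | append_singleton y c _ =>
      rw [← List.append_assoc, List.append_singleton_inj] at hu
      exact absurd (by simp [hv.1, hu.2]) ha

/-- A rotation of the channel word that starts with the top of stack `k` determines this stack. -/
theorem word_eq [DecidableEq K] {ks : List K} (hks : ks.Nodup) {k : K} (hk : k ∈ ks)
    {S : K → List Γ} {w : List (Sym K Γ)} (h : w ++ [.top k] ~r word ks S) :
    ∃ t, w = t ++ .bot :: (S k).reverse.map .sym ∧
      ∀ l, word ks (Function.update S k l) ~r t ++ block k l := by
  obtain ⟨t, ht, hl⟩ := word_split hks hk S
  refine ⟨t, ?_, hl⟩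
  have := h.trans (by simpa using hl (S k))
  rw [block, ← List.append_assoc] at this
  refine eq_of_isRotated_concat this ?_
  simp [ht]

theorem eq_cons_of_concat_sym {w t : List (Sym K Γ)} {g : Γ} {l : List Γ}
    (h : w ++ [.sym g] = t ++ .bot :: l.reverse.map .sym) :
    ∃ l', l = g :: l' ∧ w = t ++ .bot :: l'.reverse.map .sym := by
  cases l with
  | nil => cases (List.append_singleton_inj.1 h).2
  | cons g' l =>
    obtain ⟨rfl, hg⟩ := List.append_singleton_inj.1
      (show w ++ [Sym.sym g] = (t ++ .bot :: l.reverse.map .sym) ++ [.sym g'] by simpa using h)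
    cases hg
    exact ⟨l, rfl, rfl⟩

theorem eq_nil_of_concat_bot {w t : List (Sym K Γ)} {l : List Γ}
    (h : w ++ [.bot] = t ++ .bot :: l.reverse.map .sym) : l = [] := by
  cases l with
  | nil => rfl
  | cons g l =>
    cases (List.append_singleton_inj.1
      (show w ++ [Sym.bot] = (t ++ .bot :: l.reverse.map .sym) ++ [.sym g] by simpa using h)).2

theorem isRotated_concat {α : Type} (a : α) (w : List α) : a :: w ~r w ++ [a] :=
  List.isRotated_append (l := [a])

theorem isRotated_concat₂ {α : Type} (a b : α) (w : List α) : a :: b :: w ~r w ++ [a] ++ [b] := by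
  simpa using List.isRotated_append (l := [a, b]) (l' := w)

theorem reaches_of_isRotated {N : Λ → TM2.Stmt (fun _ : K => Γ) Λ σ} {A : Finset Λ}
    (q : Stmts N A) (v : σ) {w w' : List (Sym K Γ)} (h : w ~r w') :
    Relation.ReflTransGen (system N A).Step (.run q v, w) (.run q v, w') := by
  obtain ⟨x, y, rfl, rfl⟩ := isRotated_iff_append.1 h
  clear h
  induction y using List.reverseRecOn generalizing x with
  | nil => simpa using .refl
  | append_singleton y c ih =>
    rw [← List.append_assoc]
    refine .head (.recv _ _ _ _ (.rotate q v c)) (.head (.send _ _ _ _ (.emit₁ q v c)) ?_)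
    simpa using ih (c :: x)

/-- The channel system can reach the configuration `c` of the machine from `s`. -/
def Simulates (N : Λ → TM2.Stmt (fun _ : K => Γ) Λ σ) (A : Finset Λ) (ks : List K)
    (s : State K Γ (Stmts N A) σ × List (Sym K Γ)) (c : TM2.Cfg (fun _ : K => Γ) Λ σ) : Prop :=
  ∃ q : Stmts N A, (∀ l, c.l = some l → l ∈ A ∧ q.1 = N l) ∧ (c.l = none → q.1 = .halt) ∧
    Relation.ReflTransGen (system N A).Step s (.run q c.var, word ks c.stk)

theorem Simulates.head {N : Λ → TM2.Stmt (fun _ : K => Γ) Λ σ} {A : Finset Λ} {ks : List K}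
    {s s' : State K Γ (Stmts N A) σ × List (Sym K Γ)}
    {c : TM2.Cfg (fun _ : K => Γ) Λ σ} (h : Simulates N A ks s' c)
    (hs : Relation.ReflTransGen (system N A).Step s s') : Simulates N A ks s c := by
  obtain ⟨q, h₁, h₂, h₃⟩ := h
  exact ⟨q, h₁, h₂, hs.trans h₃⟩

theorem mem_stmts {N : Λ → TM2.Stmt (fun _ : K => Γ) Λ σ} {A : Finset Λ} {l : Λ} (hl : l ∈ A) :
    some (N l) ∈ TM2.stmts N A := by
  simp only [TM2.stmts, Finset.some_mem_insertNone, Finset.mem_biUnion]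
  exact ⟨l, hl, TM2.stmts₁_self⟩

section

variable [DecidableEq K] {N : Λ → TM2.Stmt (fun _ : K => Γ) Λ σ} {A : Finset Λ} {ks : List K}

/-- The channel contains stacks for which the execution of the statement `q` leads to a
configuration that the machine reaches from `c₀`. -/
def Sound (N : Λ → TM2.Stmt (fun _ : K => Γ) Λ σ) (ks : List K)
    (c₀ : TM2.Cfg (fun _ : K => Γ) Λ σ) (q : TM2.Stmt (fun _ : K => Γ) Λ σ) (v : σ)
    (w : List (Sym K Γ)) : Prop :=
  ∃ S : K → List Γ, w ~r word ks S ∧ StateTransition.Reaches (TM2.step N) c₀ (TM2.stepAux q v S)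

theorem Sound.of_isRotated {c₀ : TM2.Cfg (fun _ : K => Γ) Λ σ}
    {q : TM2.Stmt (fun _ : K => Γ) Λ σ} {v : σ} {w w' : List (Sym K Γ)}
    (h : Sound N ks c₀ q v w) (hw : w' ~r w) : Sound N ks c₀ q v w' := by
  obtain ⟨S, hS, hr⟩ := h
  exact ⟨S, hw.trans hS, hr⟩

/-- The invariant of the simulation: the messages that were received or are to be sent are put back
into the channel. -/
def Inv (N : Λ → TM2.Stmt (fun _ : K => Γ) Λ σ) (A : Finset Λ) (ks : List K)
    (c₀ : TM2.Cfg (fun _ : K => Γ) Λ σ) : State K Γ (Stmts N A) σ × List (Sym K Γ) → Prop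
  | (.run q v, w) => Sound N ks c₀ q.1 v w
  | (.emit₁ q v c, w) => Sound N ks c₀ q.1 v (c :: w)
  | (.emit₂ q v c c', w) => Sound N ks c₀ q.1 v (c' :: c :: w)
  | (.look q v k, w) => Sound N ks c₀ q.1 v (w ++ [.top k])

theorem Inv.step (hks : ks.Nodup) (hks' : ∀ k, k ∈ ks) {c₀ : TM2.Cfg (fun _ : K => Γ) Λ σ}
    {c d : State K Γ (Stmts N A) σ × List (Sym K Γ)} (h : Inv N A ks c₀ c)
    (hs : (system N A).Step c d) : Inv N A ks c₀ d := by
  cases hs with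
  | send s s' c w ht => cases ht <;> exact h
  | recv s s' c w ht =>
    cases ht with
    | rotate => exact h.of_isRotated (isRotated_concat _ _)
    | push q q' v k f hq =>
      obtain ⟨S, hS, hr⟩ := h
      obtain ⟨t, rfl, hl⟩ := word_eq hks (hks' k) hS
      rw [hq, TM2.stepAux] at hr
      refine ⟨_, (isRotated_concat₂ _ _ _).trans ?_, hr⟩
      simpa [block] using (hl (f v :: S k)).symm
    | pop q q' v k f hq => exact h
    | pop_sym q q' v k f g hq =>
      obtain ⟨S, hS, hr⟩ := h
      obtain ⟨t, ht, hl⟩ := word_eq hks (hks' k) hS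
      obtain ⟨l, hSk, rfl⟩ := eq_cons_of_concat_sym ht
      rw [hq, TM2.stepAux, hSk] at hr
      refine ⟨_, (isRotated_concat _ _).trans ?_, hr⟩
      simpa [block] using (hl l).symm
    | pop_bot q q' v k f hq =>
      obtain ⟨S, hS, hr⟩ := h
      obtain ⟨t, ht, hl⟩ := word_eq hks (hks' k) hS
      have hSk := eq_nil_of_concat_bot ht
      rw [hq, TM2.stepAux, hSk, List.tail_nil, ← hSk, Function.update_eq_self, hSk] at hr
      exact ⟨S, (isRotated_concat₂ _ _ _).trans hS, hr⟩
    | peek q q' v k f hq => exact h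
    | peek_sym q q' v k f g hq =>
      obtain ⟨S, hS, hr⟩ := h
      obtain ⟨t, ht, hl⟩ := word_eq hks (hks' k) hS
      obtain ⟨l, hSk, -⟩ := eq_cons_of_concat_sym ht
      rw [hq, TM2.stepAux, hSk] at hr
      exact ⟨S, (isRotated_concat₂ _ _ _).trans hS, hr⟩
    | peek_bot q q' v k f hq =>
      obtain ⟨S, hS, hr⟩ := h
      obtain ⟨t, ht, hl⟩ := word_eq hks (hks' k) hS
      rw [hq, TM2.stepAux, eq_nil_of_concat_bot ht] at hr
      exact ⟨S, (isRotated_concat₂ _ _ _).trans hS, hr⟩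
  | skip s s' w ht =>
    cases ht with
    | load q q' v f hq =>
      obtain ⟨S, hS, hr⟩ := h
      rw [hq, TM2.stepAux] at hr
      exact ⟨S, hS, hr⟩
    | branch_true q q' v f q₂ hq hf =>
      obtain ⟨S, hS, hr⟩ := h
      rw [hq, TM2.stepAux, hf] at hr
      exact ⟨S, hS, hr⟩
    | branch_false q q' v f q₁ hq hf =>
      obtain ⟨S, hS, hr⟩ := h
      rw [hq, TM2.stepAux, hf] at hr
      exact ⟨S, hS, hr⟩
    | goto q q' v l hq hq' =>
      obtain ⟨S, hS, hr⟩ := h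
      rw [hq, TM2.stepAux] at hr
      refine ⟨S, hS, hr.tail ?_⟩
      rw [hq']
      rfl

theorem eval_dom_of_reachable (hks : ks.Nodup) (hks' : ∀ k, k ∈ ks) {l : Λ} {q₀ : Stmts N A}
    (hq₀ : q₀.1 = N l) {v : σ} {S : K → List Γ} {s : State K Γ (Stmts N A) σ}
    (hs : s ∈ haltStates N A) (h : (system N A).StateReachable (.run q₀ v, word ks S) s) :
    (StateTransition.eval (TM2.step N) ⟨some l, v, S⟩).Dom := by
  obtain ⟨w, h⟩ := h
  have hI : Inv N A ks ⟨some l, v, S⟩ (s, w) := by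
    generalize hd : (s, w) = d at h
    clear hd
    induction h with
    | refl => exact ⟨S, .refl _, by rw [hq₀]; exact .single rfl⟩
    | tail _ hs ih => exact ih.step hks hks' hs
  obtain ⟨q, v', rfl, hq⟩ := hs
  obtain ⟨S', -, hr⟩ := hI
  rw [hq] at hr
  exact Part.dom_iff_mem.2 ⟨_, StateTransition.mem_eval.2 ⟨hr, rfl⟩⟩

theorem simulates_stepAux (hks : ks.Nodup) (hks' : ∀ k, k ∈ ks)
    (q : TM2.Stmt (fun _ : K => Γ) Λ σ) (hq : some q ∈ TM2.stmts N A) (v : σ) (S : K → List Γ)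
    (hA : TM2.SupportsStmt A q) :
    Simulates N A ks (.run ⟨q, hq⟩ v, word ks S) (TM2.stepAux q v S) := by
  induction q generalizing v S with
  | push k f q ih =>
    have hq' : some q ∈ TM2.stmts N A :=
      TM2.stmts_trans (by simp [TM2.stmts₁, TM2.stmts₁_self]) hq
    refine (ih hq' v _ hA).head ?_
    obtain ⟨t, -, hl⟩ := word_split hks (hks' k) S
    refine (reaches_of_isRotated _ v (by simpa [block] using hl (S k) :
      word ks S ~r (t ++ .bot :: (S k).reverse.map .sym) ++ [.top k])).trans ?_
    refine .head (.recv _ _ _ _ (.push _ ⟨q, hq'⟩ v k f rfl)) ?_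
    refine .head (.send _ _ _ _ (.emit₂ _ _ _ _)) (.head (.send _ _ _ _ (.emit₁ _ _ _)) ?_)
    refine reaches_of_isRotated _ v ((isRotated_concat₂ _ _ _).trans ?_)
    simpa [block] using (hl (f v :: S k)).symm
  | peek k f q ih =>
    have hq' : some q ∈ TM2.stmts N A :=
      TM2.stmts_trans (by simp [TM2.stmts₁, TM2.stmts₁_self]) hq
    refine (ih hq' _ _ hA).head ?_
    obtain ⟨t, -, hl⟩ := word_split hks (hks' k) S
    have hw : word ks S ~r (t ++ .bot :: (S k).reverse.map .sym) ++ [.top k] := by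
      simpa [block] using hl (S k)
    refine (reaches_of_isRotated _ v hw).trans ?_
    refine .head (.recv _ _ _ _ (.peek _ ⟨q, hq'⟩ v k f rfl)) ?_
    cases hSk : S k with
    | nil =>
      refine .head (.recv _ _ .bot t (Trans.peek_bot _ ⟨q, hq'⟩ v k f rfl)) ?_
      refine .head (.send _ _ _ _ (.emit₂ _ _ _ _)) (.head (.send _ _ _ _ (.emit₁ _ _ _)) ?_)
      refine reaches_of_isRotated _ _ ((isRotated_concat₂ _ _ _).trans ?_)
      simpa [hSk] using hw.symm
    | cons g l =>
      have : t ++ .bot :: (g :: l).reverse.map .sym =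
          (t ++ .bot :: l.reverse.map (.sym : Γ → Sym K Γ)) ++ [.sym g] := by simp
      rw [this]
      refine .head (.recv _ _ _ _ (.peek_sym _ ⟨q, hq'⟩ v k f g rfl)) ?_
      refine .head (.send _ _ _ _ (.emit₂ _ _ _ _)) (.head (.send _ _ _ _ (.emit₁ _ _ _)) ?_)
      refine reaches_of_isRotated _ _ ((isRotated_concat₂ _ _ _).trans ?_)
      simpa [hSk] using hw.symm
  | pop k f q ih =>
    have hq' : some q ∈ TM2.stmts N A :=
      TM2.stmts_trans (by simp [TM2.stmts₁, TM2.stmts₁_self]) hq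
    refine (ih hq' _ _ hA).head ?_
    obtain ⟨t, -, hl⟩ := word_split hks (hks' k) S
    have hw : word ks S ~r (t ++ .bot :: (S k).reverse.map .sym) ++ [.top k] := by
      simpa [block] using hl (S k)
    refine (reaches_of_isRotated _ v hw).trans ?_
    refine .head (.recv _ _ _ _ (.pop _ ⟨q, hq'⟩ v k f rfl)) ?_
    cases hSk : S k with
    | nil =>
      refine .head (.recv _ _ .bot t (Trans.pop_bot _ ⟨q, hq'⟩ v k f rfl)) ?_
      refine .head (.send _ _ _ _ (.emit₂ _ _ _ _)) (.head (.send _ _ _ _ (.emit₁ _ _ _)) ?_)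
      refine reaches_of_isRotated _ _ ((isRotated_concat₂ _ _ _).trans ?_)
      simpa [block] using (hl []).symm
    | cons g l =>
      have : t ++ .bot :: (g :: l).reverse.map .sym =
          (t ++ .bot :: l.reverse.map (.sym : Γ → Sym K Γ)) ++ [.sym g] := by simp
      rw [this]
      refine .head (.recv _ _ _ _ (.pop_sym _ ⟨q, hq'⟩ v k f g rfl)) ?_
      refine .head (.send _ _ _ _ (.emit₁ _ _ _)) ?_
      refine reaches_of_isRotated _ _ ((isRotated_concat _ _).trans ?_)
      simpa [block] using (hl l).symm
  | load f q ih =>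
    have hq' : some q ∈ TM2.stmts N A :=
      TM2.stmts_trans (by simp [TM2.stmts₁, TM2.stmts₁_self]) hq
    exact (ih hq' _ _ hA).head (.single (.skip _ _ _ (.load _ ⟨q, hq'⟩ v f rfl)))
  | branch f q₁ q₂ ih₁ ih₂ =>
    have hq₁ : some q₁ ∈ TM2.stmts N A :=
      TM2.stmts_trans (by simp [TM2.stmts₁, TM2.stmts₁_self]) hq
    have hq₂ : some q₂ ∈ TM2.stmts N A :=
      TM2.stmts_trans (by simp [TM2.stmts₁, TM2.stmts₁_self]) hq
    rw [TM2.stepAux]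
    cases hf : f v with
    | true =>
      exact (ih₁ hq₁ _ _ hA.1).head
        (.single (.skip _ _ _ (.branch_true _ ⟨q₁, hq₁⟩ v f q₂ rfl hf)))
    | false =>
      exact (ih₂ hq₂ _ _ hA.2).head
        (.single (.skip _ _ _ (.branch_false _ ⟨q₂, hq₂⟩ v f q₁ rfl hf)))
  | goto l =>
    refine ⟨⟨N (l v), mem_stmts (hA v)⟩, ?_, by simp, ?_⟩
    · rintro _ ⟨⟩
      exact ⟨hA v, rfl⟩
    · exact .single (.skip _ _ _ (.goto _ _ v l rfl rfl))
  | halt => exact ⟨⟨.halt, hq⟩, by simp, fun _ => rfl, .refl⟩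

theorem reachable_of_eval_dom (hks : ks.Nodup) (hks' : ∀ k, k ∈ ks)
    (hA : ∀ l ∈ A, TM2.SupportsStmt A (N l)) {l : Λ} (hl : l ∈ A) {v : σ} {S : K → List Γ}
    (h : (StateTransition.eval (TM2.step N) ⟨some l, v, S⟩).Dom) :
    ∃ s ∈ haltStates N A,
      (system N A).StateReachable (.run ⟨N l, mem_stmts hl⟩ v, word ks S) s := by
  obtain ⟨c, hc⟩ := Part.dom_iff_mem.1 h
  obtain ⟨hr, hn⟩ := StateTransition.mem_eval.1 hc
  have hsim : Simulates N A ks (.run ⟨N l, mem_stmts hl⟩ v, word ks S) c := by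
    clear hc hn h
    induction hr with
    | refl => exact ⟨⟨N l, mem_stmts hl⟩, by simpa using hl, by simp, .refl⟩
    | @tail c d _ hd ih =>
      obtain ⟨q, hq, -, hr⟩ := ih
      obtain ⟨_ | l', v', S'⟩ := c
      · simp at hd
      · obtain ⟨hl', hq⟩ := hq l' rfl
        obtain rfl : TM2.stepAux (N l') v' S' = d := by simpa using hd
        obtain ⟨q, hq'⟩ := q
        obtain rfl : q = N l' := hq
        exact (simulates_stepAux hks hks' (N l') (mem_stmts hl') v' S' (hA l' hl')).head hr
  obtain ⟨q, -, hq, hr⟩ := hsim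
  obtain ⟨_ | l', v', S'⟩ := c
  · exact ⟨_, ⟨q, v', rfl, hq rfl⟩, _, hr⟩
  · simp at hn

end

end StackQueue

/-! ### Isomorphic programs -/

/-- Renaming all the components of TSO configurations. -/
def TSOConf.congr {ι ι' V V' D D' : Type} {Q : ι → Type} {Q' : ι' → Type} (eι : ι ≃ ι')
    (eV : V ≃ V') (eD : D ≃ D') (eQ : ∀ i, Q i ≃ Q' (eι i)) :
    TSOConf ι V D Q ≃ TSOConf ι' V' D' Q' where
  toFun c := ⟨Equiv.piCongr eι eQ c.state,
    eι.arrowCongr (Equiv.listEquivOfEquiv (eV.prodCongr eD)) c.buf, eV.arrowCongr eD c.mem⟩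
  invFun c := ⟨(Equiv.piCongr eι eQ).symm c.state,
    (eι.arrowCongr (Equiv.listEquivOfEquiv (eV.prodCongr eD))).symm c.buf,
    (eV.arrowCongr eD).symm c.mem⟩
  left_inv c := by simp only [Equiv.symm_apply_apply]
  right_inv c := by simp only [Equiv.apply_symm_apply]

section

variable {ι ι' V V' D D' : Type} {Q : ι → Type} {Q' : ι' → Type} (eι : ι ≃ ι')
  (eV : V ≃ V') (eD : D ≃ D') (eQ : ∀ i, Q i ≃ Q' (eι i))

theorem TSOConf.congr_state (c : TSOConf ι V D Q) (i : ι) :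
    (TSOConf.congr eι eV eD eQ c).state (eι i) = eQ i (c.state i) :=
  Equiv.piCongr_apply_apply _ _ _ _

theorem TSOConf.congr_buf (c : TSOConf ι V D Q) (i : ι) :
    (TSOConf.congr eι eV eD eQ c).buf (eι i) = (c.buf i).map (Prod.map eV eD) := by
  simp [TSOConf.congr, Equiv.arrowCongr, Equiv.listEquivOfEquiv]

theorem TSOConf.congr_update [DecidableEq ι] [DecidableEq ι'] (c : TSOConf ι V D Q) (i : ι)
    (q : Q i) (b : List (V × D)) (m : V → D) :
    TSOConf.congr eι eV eD eQ ⟨Function.update c.state i q, Function.update c.buf i b, m⟩ =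
      ⟨Function.update (TSOConf.congr eι eV eD eQ c).state (eι i) (eQ i q),
        Function.update (TSOConf.congr eι eV eD eQ c).buf (eι i) (b.map (Prod.map eV eD)),
        eV.arrowCongr eD m⟩ := by
  rw [TSOConf.mk.injEq]
  refine ⟨?_, ?_, rfl⟩
  · funext j
    obtain ⟨j, rfl⟩ := eι.surjective j
    refine (TSOConf.congr_state eι eV eD eQ ⟨_, _, _⟩ j).trans ?_
    by_cases hj : j = i
    · subst hj
      simp
    · dsimp only
      rw [Function.update_of_ne hj, Function.update_of_ne (eι.injective.ne hj),
        TSOConf.congr_state]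
  · funext j
    obtain ⟨j, rfl⟩ := eι.surjective j
    refine (TSOConf.congr_buf eι eV eD eQ ⟨_, _, _⟩ j).trans ?_
    by_cases hj : j = i
    · subst hj
      simp
    · dsimp only
      rw [Function.update_of_ne hj, Function.update_of_ne (eι.injective.ne hj),
        TSOConf.congr_buf]

theorem arrowCongr_update [DecidableEq V] [DecidableEq V'] (m : V → D) (x : V) (d : D) :
    eV.arrowCongr eD (Function.update m x d) =
      Function.update (eV.arrowCongr eD m) (eV x) (eD d) := by
  funext y
  obtain ⟨y, rfl⟩ := eV.surjective y
  by_cases hy : y = x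
  · subst hy
    simp
  · simp [Function.update_of_ne hy, Function.update_of_ne (eV.injective.ne hy)]

theorem Instr.map_injective {f : V → V'} {g : D → D'} (hf : Function.Injective f)
    (hg : Function.Injective g) : Function.Injective (Instr.map f g) := by
  rintro (_ | _ | _ | _ | _) (_ | _ | _ | _ | _) h <;> simp_all [Instr.map, hf.eq_iff, hg.eq_iff]

theorem Instr.map_surjective {f : V → V'} {g : D → D'} (hf : Function.Surjective f)
    (hg : Function.Surjective g) : Function.Surjective (Instr.map f g) := by
  rintro (⟨x, d⟩ | ⟨x, d⟩ | ⟨x, d, d'⟩ | _ | _)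
  · obtain ⟨x, rfl⟩ := hf x
    obtain ⟨d, rfl⟩ := hg d
    exact ⟨.rd x d, rfl⟩
  · obtain ⟨x, rfl⟩ := hf x
    obtain ⟨d, rfl⟩ := hg d
    exact ⟨.wr x d, rfl⟩
  · obtain ⟨x, rfl⟩ := hf x
    obtain ⟨d, rfl⟩ := hg d
    obtain ⟨d', rfl⟩ := hg d'
    exact ⟨.arw x d d', rfl⟩
  · exact ⟨.nop, rfl⟩
  · exact ⟨.mf, rfl⟩

variable [DecidableEq V] [DecidableEq V']

theorem readVal_map (b : List (V × D)) (m : V → D) (x : V) :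
    readVal (b.map (Prod.map eV eD)) (eV.arrowCongr eD m) (eV x) = eD (readVal b m x) := by
  have : (b.map (Prod.map eV eD)).filter (fun e => e.1 = eV x) =
      (b.filter (fun e => e.1 = x)).map (Prod.map eV eD) := by
    rw [List.filter_map]
    simp [Function.comp_def]
  rw [readVal, readVal, this]
  cases b.filter (fun e => e.1 = x) <;> simp

theorem Instr.eff_map {a : Instr V D} {b b' : List (V × D)} {m m' : V → D} :
    (a.map eV eD).Eff (b.map (Prod.map eV eD)) (eV.arrowCongr eD m) (b'.map (Prod.map eV eD))
      (eV.arrowCongr eD m') ↔ a.Eff b m b' m' := by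
  have hinj : ∀ b b' : List (V × D),
      b'.map (Prod.map eV eD) = b.map (Prod.map eV eD) ↔ b' = b := fun b b' =>
    (List.map_injective_iff.2 (eV.injective.prodMap eD.injective)).eq_iff
  cases a with
  | rd x d => simp only [Instr.map, Instr.Eff, readVal_map, hinj, EmbeddingLike.apply_eq_iff_eq]
  | wr x d =>
    have := hinj ((x, d) :: b) b'
    rw [List.map_cons, Prod.map_apply] at this
    simp only [Instr.map, Instr.Eff, this, EmbeddingLike.apply_eq_iff_eq]
  | arw x d d' =>
    have : eV.arrowCongr eD m (eV x) = eD (m x) := by simp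
    simp only [Instr.map, Instr.Eff, this, hinj, ← arrowCongr_update, List.map_eq_nil_iff,
      EmbeddingLike.apply_eq_iff_eq]
  | nop => simp only [Instr.map, Instr.Eff, hinj, EmbeddingLike.apply_eq_iff_eq]
  | mf => simp only [Instr.map, Instr.Eff, hinj, List.map_eq_nil_iff, EmbeddingLike.apply_eq_iff_eq]

variable [DecidableEq ι] [DecidableEq ι']

theorem Program.step_congr {P : Program ι V D Q} {P' : Program ι' V' D' Q'}
    (hP : ∀ i q a q', P'.trans (eι i) (eQ i q) (a.map eV eD) (eQ i q') ↔ P.trans i q a q')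
    {c d : TSOConf ι V D Q} :
    P'.Step (TSOConf.congr eι eV eD eQ c) (TSOConf.congr eι eV eD eQ d) ↔ P.Step c d := by
  rw [Program.step_iff, Program.step_iff]
  constructor
  · rintro ⟨i, a, q, b, m, ht, he, hd⟩
    obtain ⟨i, rfl⟩ := eι.surjective i
    obtain ⟨a, rfl⟩ := Instr.map_surjective eV.surjective eD.surjective a
    obtain ⟨q, rfl⟩ := (eQ i).surjective q
    obtain ⟨b, rfl⟩ := (List.map_surjective_iff.2
      (Function.Surjective.prodMap eV.surjective eD.surjective)) b
    obtain ⟨m, rfl⟩ := (eV.arrowCongr eD).surjective m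
    rw [TSOConf.congr_state, hP] at ht
    rw [TSOConf.congr_buf] at he
    rw [← TSOConf.congr_update, EmbeddingLike.apply_eq_iff_eq] at hd
    exact ⟨i, a, q, b, m, ht, (Instr.eff_map eV eD).1 he, hd⟩
  · rintro ⟨i, a, q, b, m, ht, he, rfl⟩
    refine ⟨eι i, a.map eV eD, eQ i q, b.map (Prod.map eV eD), eV.arrowCongr eD m, ?_, ?_,
      TSOConf.congr_update eι eV eD eQ c i q b m⟩
    · rw [TSOConf.congr_state, hP]
      exact ht
    · rw [TSOConf.congr_buf]
      exact (Instr.eff_map eV eD).2 he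

theorem TSOConf.update_congr {c d : TSOConf ι V D Q} :
    (TSOConf.congr eι eV eD eQ c).Update (TSOConf.congr eι eV eD eQ d) ↔ c.Update d := by
  rw [TSOConf.update_iff, TSOConf.update_iff]
  constructor
  · rintro ⟨i, x, v, w, hw, hd⟩
    obtain ⟨i, rfl⟩ := eι.surjective i
    obtain ⟨x, rfl⟩ := eV.surjective x
    obtain ⟨v, rfl⟩ := eD.surjective v
    obtain ⟨w, rfl⟩ := (List.map_surjective_iff.2
      (Function.Surjective.prodMap eV.surjective eD.surjective)) w
    have hinj := List.map_injective_iff.2 (eV.injective.prodMap eD.injective)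
    refine ⟨i, x, v, w, hinj ?_, ?_⟩
    · rw [← TSOConf.congr_buf eι eV eD eQ, hw]
      simp
    · rw [← EmbeddingLike.apply_eq_iff_eq (TSOConf.congr eι eV eD eQ), hd,
        ← Function.update_eq_self i c.state, TSOConf.congr_update, ← TSOConf.congr_state,
        Function.update_eq_self, arrowCongr_update]
      rfl
  · rintro ⟨i, x, v, w, hw, rfl⟩
    refine ⟨eι i, eV x, eD v, w.map (Prod.map eV eD), ?_, ?_⟩
    · rw [TSOConf.congr_buf, hw]
      simp
    · conv_lhs => rw [← Function.update_eq_self i c.state]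
      rw [TSOConf.congr_update, ← TSOConf.congr_state, Function.update_eq_self, arrowCongr_update]
      rfl

theorem TSOConf.updates_congr {c d : TSOConf ι V D Q} :
    (TSOConf.congr eι eV eD eQ c).Updates (TSOConf.congr eι eV eD eQ d) ↔ c.Updates d := by
  constructor
  · intro h
    have := h.lift (p := TSOConf.Update) (TSOConf.congr eι eV eD eQ).symm (fun a b hab => by
      rw [Function.onFun, ← TSOConf.update_congr eι eV eD eQ]
      simpa using hab)
    simpa [Function.onFun, TSOConf.Updates] using this
  · exact fun h => h.lift (p := TSOConf.Update) (TSOConf.congr eι eV eD eQ)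
      fun _ _ => (TSOConf.update_congr eι eV eD eQ).2

theorem Program.move_congr {P : Program ι V D Q} {P' : Program ι' V' D' Q'}
    (hP : ∀ i q a q', P'.trans (eι i) (eQ i q) (a.map eV eD) (eQ i q') ↔ P.trans i q a q')
    (F : Set (Σ i, Q i)) (F' : Set (Σ i, Q' i)) (g g' : Player × TSOConf ι V D Q) :
    (P'.atsoGame F').move (g.1, TSOConf.congr eι eV eD eQ g.2)
      (g'.1, TSOConf.congr eι eV eD eQ g'.2) ↔ (P.atsoGame F).move g g' := by
  simp only [Program.atsoGame, Program.tsoGame]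
  refine and_congr_right fun _ => ?_
  rw [(TSOConf.congr eι eV eD eQ).symm.exists_congr_left]
  refine exists_congr fun c => ?_
  rw [(TSOConf.congr eι eV eD eQ).symm.exists_congr_left]
  refine exists_congr fun c' => ?_
  simp only [Equiv.symm_symm, TSOConf.updates_congr, Program.step_congr eι eV eD eQ hP,
    EmbeddingLike.apply_eq_iff_eq]

end

/-! ### Finite descriptions of the programs of channel systems -/

instance : Finite PIdx :=
  Finite.of_injective (β := Fin 3) (fun | .p1 => 0 | .p2 => 1 | .p3 => 2) (by
    rintro (_ | _ | _) (_ | _ | _) h <;> simp_all)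

instance : Finite PVar :=
  Finite.of_injective (β := Fin 3) (fun | .xwr => 0 | .xrd => 1 | .y => 2) (by
    rintro (_ | _ | _) (_ | _ | _) h <;> simp_all)

instance {M : Type} [Finite M] : Finite (PVal M) :=
  Finite.of_injective (β := M ⊕ Fin 3)
    (fun | .msg m => .inl m | .zero => .inr 0 | .one => .inr 1 | .bot => .inr 2) (by
    rintro (_ | _ | _ | _) (_ | _ | _ | _) h <;> simp_all)

instance {M : Type} [Finite M] : Finite (ChanOp M) :=
  Finite.of_injective (β := M ⊕ M ⊕ Unit)
    (fun | .send m => .inl m | .recv m => .inr (.inl m) | .nop => .inr (.inr ())) (by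
    rintro (_ | _ | _) (_ | _ | _) h <;> simp_all)

instance : Finite Aux :=
  Finite.of_surjective (α := Fin 6)
    (fun | 0 => .h1 | 1 => .h2 | 2 => .h3 | 3 => .h4 | 4 => .h5 | 5 => .h6) (by
    rintro (_ | _ | _ | _ | _ | _)
    exacts [⟨0, rfl⟩, ⟨1, rfl⟩, ⟨2, rfl⟩, ⟨3, rfl⟩, ⟨4, rfl⟩, ⟨5, rfl⟩])

instance {S M : Type} [Finite S] [Finite M] : Finite (P1State S M) :=
  Finite.of_injective (β := S ⊕ S × ChanOp M × S × Aux)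
    (fun | .chan s => .inl s | .aux s o s' h => .inr (s, o, s', h)) (by
    rintro (_ | _) (_ | _) h <;> simp_all)

instance {M : Type} [Finite M] : Finite (P2State M) :=
  Finite.of_surjective (α := M ⊕ Fin 10)
    (fun
      | .inl m => .qmsg m
      | .inr 0 => .q1 | .inr 1 => .q3 | .inr 2 => .q4 | .inr 3 => .q5 | .inr 4 => .q6
      | .inr 5 => .q7 | .inr 6 => .q8 | .inr 7 => .q9 | .inr 8 => .q10 | .inr 9 => .qF) (by
    rintro (_ | m | _ | _ | _ | _ | _ | _ | _ | _ | _)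
    exacts [⟨.inr 0, rfl⟩, ⟨.inl m, rfl⟩, ⟨.inr 1, rfl⟩, ⟨.inr 2, rfl⟩, ⟨.inr 3, rfl⟩,
      ⟨.inr 4, rfl⟩, ⟨.inr 5, rfl⟩, ⟨.inr 6, rfl⟩, ⟨.inr 7, rfl⟩, ⟨.inr 8, rfl⟩, ⟨.inr 9, rfl⟩])

instance : Finite P3State :=
  Finite.of_surjective (α := Fin 4) (fun | 0 => .r1 | 1 => .r2 | 2 => .r3 | 3 => .rF) (by
    rintro (_ | _ | _ | _)
    exacts [⟨0, rfl⟩, ⟨1, rfl⟩, ⟨2, rfl⟩, ⟨3, rfl⟩])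

instance {S M : Type} [Finite S] [Finite M] (i : PIdx) : Finite (PState S M i) :=
  match i with
  | .p1 => inferInstanceAs (Finite (P1State S M))
  | .p2 => inferInstanceAs (Finite (P2State M))
  | .p3 => inferInstanceAs (Finite P3State)

instance {V D : Type} [Finite V] [Finite D] : Finite (Instr V D) :=
  Finite.of_equiv _ (Instr.equivSum V D).symm

namespace PCS

variable {S M : Type} [Finite S] [Finite M]

/-- A transition with its states, variables and values replaced by their numbers. -/
noncomputable def codeTrans {i : PIdx}
    (t : PState S M i × Instr PVar (PVal M) × PState S M i) : ℕ × Instr ℕ ℕ × ℕ :=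
  (Finite.equivFin _ t.1,
    (t.2.1.map (Finite.equivFin PVar) (Finite.equivFin (PVal M))).map Fin.val Fin.val,
    Finite.equivFin _ t.2.2)

theorem codeTrans_injective {i : PIdx} :
    Function.Injective (codeTrans (S := S) (M := M) (i := i)) := by
  rintro ⟨q, a, q'⟩ ⟨r, b, r'⟩ h
  simp only [codeTrans, Prod.mk.injEq, Fin.val_inj, EmbeddingLike.apply_eq_iff_eq] at h
  obtain ⟨rfl, h, rfl⟩ := h
  have h := Instr.map_injective Fin.val_injective Fin.val_injective h
  rw [Instr.map_injective (Equiv.injective _) (Equiv.injective _) h]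

/-- The finite description of a process of the program of `L`. -/
noncomputable def procCode (L : PCS S M) (i : PIdx) : ProcCode :=
  (Nat.card (PState S M i),
    ((Set.toFinite {t : PState S M i × Instr PVar (PVal M) × PState S M i |
      L.program.trans i t.1 t.2.1 t.2.2}).toFinset.toList).map codeTrans)

theorem codeTrans_mem_procCode (L : PCS S M) (i : PIdx)
    (t : PState S M i × Instr PVar (PVal M) × PState S M i) :
    codeTrans t ∈ (L.procCode i).2 ↔ L.program.trans i t.1 t.2.1 t.2.2 := by
  rw [procCode, List.mem_map_of_injective codeTrans_injective]
  simp

/-- The finite description of the program of `L`. -/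
noncomputable def progCode (L : PCS S M) : ProgCode :=
  (Nat.card PVar, Nat.card (PVal M), [L.procCode .p1, L.procCode .p2, L.procCode .p3])

/-- The numbering of the processes. -/
def idxEquiv : PIdx ≃ Fin 3 where
  toFun | .p1 => 0 | .p2 => 1 | .p3 => 2
  invFun | 0 => .p1 | 1 => .p2 | 2 => .p3
  left_inv i := by cases i <;> rfl
  right_inv i := by fin_cases i <;> rfl

theorem progCode_get (L : PCS S M) (i : PIdx) :
    L.progCode.2.2.get (idxEquiv i) = L.procCode i := by
  cases i <;> rfl

/-- The numbering of the local states. -/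
noncomputable def stateEquiv (L : PCS S M) (i : PIdx) :
    PState S M i ≃ L.progCode.LocalState (idxEquiv i) :=
  (Finite.equivFin _).trans (finCongr (by rw [progCode_get]; rfl))

theorem toProgram_progCode (L : PCS S M) (i : PIdx) (q : PState S M i)
    (a : Instr PVar (PVal M)) (q' : PState S M i) :
    L.progCode.toProgram.trans (idxEquiv i) (L.stateEquiv i q)
      (a.map (Finite.equivFin PVar) (Finite.equivFin (PVal M))) (L.stateEquiv i q') ↔
      L.program.trans i q a q' := by
  rw [← L.codeTrans_mem_procCode i (q, a, q'), ← progCode_get]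
  rfl

/-- The configurations of the described game. -/
noncomputable def confEquiv (L : PCS S M) :
    Player × TSOConf PIdx PVar (PVal M) (PState S M) ≃
      Player × TSOConf L.progCode.Idx L.progCode.Var L.progCode.Val L.progCode.LocalState :=
  (Equiv.refl _).prodCongr (TSOConf.congr (ι' := L.progCode.Idx) (Q' := L.progCode.LocalState)
    idxEquiv (Finite.equivFin PVar) (Finite.equivFin (PVal M)) L.stateEquiv)

/-- The finite description of the final local states. -/
noncomputable def finalCode (L : PCS S M) (SF : Set S) : List (ℕ × ℕ) :=
  (Set.toFinite (programFinal (M := M) SF)).toFinset.toList.map fun p =>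
    ((idxEquiv p.1 : ℕ), (L.stateEquiv p.1 p.2 : ℕ))

theorem mem_finalStates (L : PCS S M) (SF : Set S) (i : PIdx) (q : PState S M i) :
    (⟨idxEquiv i, L.stateEquiv i q⟩ : Σ i, L.progCode.LocalState i) ∈
      L.progCode.finalStates (L.finalCode SF) ↔ (⟨i, q⟩ : Σ i, PState S M i) ∈ programFinal SF := by
  have hinj : Function.Injective fun p : Σ i, PState S M i =>
      ((idxEquiv p.1 : ℕ), (L.stateEquiv p.1 p.2 : ℕ)) := by
    rintro ⟨i, q⟩ ⟨j, r⟩ h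
    simp only [Prod.mk.injEq, Fin.val_inj, EmbeddingLike.apply_eq_iff_eq] at h
    obtain ⟨rfl, h⟩ := h
    rw [Fin.val_inj, EmbeddingLike.apply_eq_iff_eq] at h
    rw [h]
  have := List.mem_map_of_injective hinj (a := ⟨i, q⟩)
    (l := (Set.toFinite (programFinal (M := M) SF)).toFinset.toList)
  exact this.trans (by simp)

theorem owner_confEquiv (L : PCS S M) (SF : Set S) (g) :
    (L.progCode.game (L.finalCode SF)).owner (L.confEquiv g) =
      (L.program.atsoGame (programFinal SF)).owner g :=
  rfl

theorem move_confEquiv (L : PCS S M) (SF : Set S) (g g') :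
    (L.progCode.game (L.finalCode SF)).move (L.confEquiv g) (L.confEquiv g') ↔
      (L.program.atsoGame (programFinal SF)).move g g' :=
  Program.move_congr idxEquiv _ _ L.stateEquiv L.toProgram_progCode _ _ g g'

theorem final_confEquiv (L : PCS S M) (SF : Set S) (g) :
    L.confEquiv g ∈ (L.progCode.game (L.finalCode SF)).final ↔
      g ∈ (L.program.atsoGame (programFinal SF)).final := by
  obtain ⟨p, c⟩ := g
  refine and_congr_right fun _ => ?_
  have h : ∀ i, (L.confEquiv (p, c)).2.state (idxEquiv i) = L.stateEquiv i (c.state i) := fun i =>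
    TSOConf.congr_state (ι' := L.progCode.Idx) (Q' := L.progCode.LocalState) idxEquiv _ _
      L.stateEquiv c i
  constructor
  · rintro ⟨i, hi⟩
    obtain ⟨i, rfl⟩ := idxEquiv.surjective i
    rw [h] at hi
    exact ⟨i, (L.mem_finalStates SF i _).1 hi⟩
  · rintro ⟨i, hi⟩
    refine ⟨idxEquiv i, ?_⟩
    rw [h]
    exact (L.mem_finalStates SF i _).2 hi

/-- The encoding of a pending write. -/
noncomputable def codeWrite (e : PVar × PVal M) : ℕ × ℕ :=
  (Finite.equivFin PVar e.1, Finite.equivFin (PVal M) e.2)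

/-- Only the store buffer of the first process depends on the channel word. -/
theorem encodeConf_startConf (L : PCS S M) (s : S) : ∃ l₁ l₃, ∀ w,
    L.progCode.encodeConf (L.confEquiv (.B, startConf s w)) =
      (.B, l₁, [(enc w).map codeWrite, [], []], l₃) := by
  let g := L.progCode.encodeConf (L.confEquiv (.B, startConf s []))
  refine ⟨g.2.1, g.2.2.2, fun w => ?_⟩
  refine Prod.ext rfl (Prod.ext ?_ (Prod.ext ?_ ?_))
  rotate_left
  · have h : ∀ i, ((L.confEquiv (.B, startConf s w)).2.buf (idxEquiv i)).map
        (fun e => ((e.1 : ℕ), (e.2 : ℕ))) = ((startConf (M := M) s w).buf i).map codeWrite := by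
      intro i
      refine (congrArg (List.map _) (TSOConf.congr_buf (ι' := L.progCode.Idx)
        (Q' := L.progCode.LocalState) idxEquiv _ _ L.stateEquiv _ i)).trans ?_
      rw [List.map_map]
      rfl
    exact congrArg₂ List.cons (h .p1) (congrArg₂ List.cons (h .p2) (congrArg₂ List.cons (h .p3) rfl))
  · rfl
  · rfl

end PCS

/-! ### Undecidability -/

namespace StackQueue

open Turing PartrecToTM2

/-- Incrementing a number in binary notation, lowest digit first. -/
def binSucc (l : List Bool) : List Bool :=
  List.rec [true] (fun b l ih => if b then false :: ih else true :: l) l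

/-- Binary notation, lowest digit first. -/
def binary (n : ℕ) : List Bool := Nat.rec [] (fun _ l => binSucc l) n

theorem primrec_binSucc : Primrec binSucc :=
  Primrec.list_rec .id (.const _) (h := fun _ (p : Bool × List Bool × List Bool) =>
    if p.1 then false :: p.2.2 else true :: p.2.1)
    (Primrec.ite (Primrec.eq.comp (Primrec.fst.comp .snd) (.const true))
      (Primrec.list_cons.comp (.const _) (Primrec.snd.comp (Primrec.snd.comp .snd)))
      (Primrec.list_cons.comp (.const _) (Primrec.fst.comp (Primrec.snd.comp .snd)))).to₂

theorem primrec_binary : Primrec binary :=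
  Primrec.nat_rec₁ [] (primrec_binSucc.comp .snd).to₂

/-- The stack symbol of a binary digit. -/
def digit (b : Bool) : Γ' := if b then .bit1 else .bit0

theorem trPosNum_succ (n : PosNum) {l : List Bool} (h : l.map digit = trPosNum n) :
    (binSucc l).map digit = trPosNum n.succ := by
  induction n generalizing l with
  | one =>
    obtain ⟨b, l, rfl, hb, hl⟩ := List.map_eq_cons_iff.1 h
    obtain rfl := List.map_eq_nil_iff.1 hl
    cases b <;> simp_all [digit, binSucc, trPosNum, PosNum.succ]
  | bit0 n =>
    obtain ⟨b, l, rfl, hb, hl⟩ := List.map_eq_cons_iff.1 h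
    cases b <;> simp_all [digit, binSucc, trPosNum, PosNum.succ]
  | bit1 n ih =>
    obtain ⟨b, l, rfl, hb, hl⟩ := List.map_eq_cons_iff.1 h
    have := ih hl
    cases b <;> simp_all [digit, binSucc, trPosNum, PosNum.succ]

theorem trNat_eq (n : ℕ) : trNat n = (binary n).map digit := by
  induction n with
  | zero => simp [binary]
  | succ n ih =>
    rw [trNat, Nat.cast_succ, Num.add_one]
    rw [trNat] at ih
    change _ = (binSucc (binary n)).map digit
    cases hn : (n : Num) with
    | zero =>
      rw [hn] at ih
      obtain hb := List.map_eq_nil_iff.1 ih.symm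
      rw [hb]
      rfl
    | pos p =>
      rw [hn] at ih
      exact (trPosNum_succ p ih.symm).symm

instance : Finite K' :=
  Finite.of_surjective (α := Fin 4) (fun | 0 => .main | 1 => .rev | 2 => .aux | 3 => .stack) (by
    rintro (_ | _ | _ | _)
    exacts [⟨0, rfl⟩, ⟨1, rfl⟩, ⟨2, rfl⟩, ⟨3, rfl⟩])

/-- The stacks of the machine. -/
def stackNames : List K' := [.main, .rev, .aux, .stack]

theorem nodup_stackNames : stackNames.Nodup := by simp [stackNames]

theorem mem_stackNames (k : K') : k ∈ stackNames := by cases k <;> simp [stackNames]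

/-- The channel word for the input `n`. -/
def input (n : ℕ) : List (Sym K' Γ') := word stackNames (K'.elim (trList [n]) [] [] [])

theorem input_eq (n : ℕ) : input n =
    [.bot, .sym .cons] ++ (binary n).reverse.map (fun b => .sym (digit b)) ++ .top .main ::
      (block .rev [] ++ block .aux [] ++ block .stack []) := by
  simp [input, word, stackNames, block, trList, trNat_eq, Function.comp_def]

/-- The channel words of inputs are computable, in any encoding of the symbols. -/
theorem computable_input {β : Type} [Primcodable β] (φ : Sym K' Γ' → List β) :
    Computable fun n => (input n).flatMap φ := by
  have h : ∀ n, (input n).flatMap φ = [.bot, .sym .cons].flatMap φ ++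
      ((binary n).reverse.flatMap fun b => φ (.sym (digit b))) ++ (Sym.top .main ::
      (block .rev [] ++ block .aux [] ++ block .stack [])).flatMap φ := by
    intro n
    rw [input_eq, List.flatMap_append, List.flatMap_append, List.flatMap_map]
  refine (Primrec.to_comp ?_).of_eq fun n => (h n).symm
  refine Primrec.list_append.comp (Primrec.list_append.comp (.const _) ?_) (.const _)
  exact Primrec.list_flatMap (Primrec.list_reverse.comp primrec_binary)
    ((Primrec.dom_finite fun b => φ (.sym (digit b))).comp .snd).to₂

end StackQueue

open Turing in
/-- There is a channel system for which it is not decidable whether a final state is reachable from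
the initial state with the channel content for an input `n`. -/
theorem exists_undecidable_system :
    ∃ (S : Type) (_ : Finite S) (L : PCS S (StackQueue.Sym PartrecToTM2.K' PartrecToTM2.Γ'))
      (s₀ : S) (SF : Set S), ∀ f : ℕ → Bool, Computable f →
        ¬ ∀ n, f n = true ↔ ∃ s ∈ SF, L.StateReachable (s₀, StackQueue.input n) s := by
  have hpart : Partrec fun n : ℕ => (Denumerable.ofNat Nat.Partrec.Code n).eval 0 :=
    Nat.Partrec.Code.eval_part.comp (Computable.ofNat _) (Computable.const 0)
  obtain ⟨c, hc⟩ := ToPartrec.Code.exists_code (Nat.Partrec'.part_iff₁.2 hpart)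
  have hsupp := PartrecToTM2.tr_supports c .halt
  have hl := hsupp.1
  have : Finite (StackQueue.Stmts (K := PartrecToTM2.K') (Γ := PartrecToTM2.Γ') PartrecToTM2.tr
    (PartrecToTM2.codeSupp c .halt)) := StackQueue.finite_stmts _ _
  refine ⟨_, inferInstance, StackQueue.system PartrecToTM2.tr (PartrecToTM2.codeSupp c .halt),
    .run ⟨_, StackQueue.mem_stmts hl⟩ none, StackQueue.haltStates _ _, fun f hf h => ?_⟩
  have key : ∀ n, f n = true ↔ ((Denumerable.ofNat Nat.Partrec.Code n).eval 0).Dom := by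
    intro n
    have hdom : (StateTransition.eval (TM2.step PartrecToTM2.tr) (PartrecToTM2.init c [n])).Dom ↔
        ((Denumerable.ofNat Nat.Partrec.Code n).eval 0).Dom := by
      rw [PartrecToTM2.tr_eval]
      have := hc (n ::ᵥ List.Vector.nil)
      change c.eval [n] = _ at this
      rw [this]
      rfl
    rw [h, ← hdom]
    constructor
    · rintro ⟨s, hs, hr⟩
      exact StackQueue.eval_dom_of_reachable StackQueue.nodup_stackNames
        StackQueue.mem_stackNames rfl hs hr
    · exact fun hd => StackQueue.reachable_of_eval_dom StackQueue.nodup_stackNames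
        StackQueue.mem_stackNames hsupp.2 hl hd
  refine ComputablePred.halting_problem 0 (ComputablePred.computable_iff.2
    ⟨fun c => f (Encodable.encode c), hf.comp Computable.encode, ?_⟩)
  funext c
  rw [key, Denumerable.ofNat_encode]

theorem not_atsoSafetyDecidable : ¬ ATSOSafetyDecidable := by
  rintro ⟨f, hf, hdec⟩
  obtain ⟨S, _, L, s₀, SF, hL⟩ := exists_undecidable_system
  obtain ⟨l₁, l₃, henc⟩ := L.encodeConf_startConf s₀
  have hdead : (L.progCode.game (L.finalCode SF)).DeadlockFree :=
    (L.deadlockFree SF).of_equiv L.confEquiv (L.move_confEquiv SF)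
  have hbuf : Computable fun n => (PCS.enc (StackQueue.input n)).map PCS.codeWrite := by
    refine (StackQueue.computable_input fun k =>
      [(.y, .one), (.xwr, .msg k)].map PCS.codeWrite).of_eq fun n => ?_
    rw [PCS.enc, List.map_flatMap]
  have hcomp : Computable fun n => f (L.progCode, L.finalCode SF, L.progCode.encodeConf
      (L.confEquiv (.B, PCS.startConf s₀ (StackQueue.input n)))) := by
    refine hf.comp (.pair (.const _) (.pair (.const _) ?_))
    refine Computable.of_eq (.pair (.const Player.B) (.pair (.const l₁) (.pair
      (Computable.list_cons.comp hbuf (.const [[], []])) (.const l₃)))) fun n => ?_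
    exact (henc _).symm
  refine hL _ (Primrec.not.to_comp.comp hcomp) fun n => ?_
  rw [Bool.not_eq_true', ← Bool.not_eq_true, hdec _ _ _ hdead]
  constructor
  · intro h
    by_contra hn
    obtain ⟨X, hX, hc⟩ := PCS.isSafe_startConf hn
    exact h ((hX.of_equiv L.confEquiv (L.owner_confEquiv SF) (L.move_confEquiv SF)
      (L.final_confEquiv SF)).winsA hdead ⟨_, hc, rfl⟩)
  · intro h hA
    exact hA.not_winsB (((PCS.attr_startConf h).of_equiv L.confEquiv (L.owner_confEquiv SF)
      (L.move_confEquiv SF) (L.final_confEquiv SF)).winsB hdead)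

theorem mainTheorem4 :
    (¬ ATSOSafetyDecidable) ∧
    (∀ (S M : Type) [Finite S] [Finite M] (L : PCS S M) (s₀ : S) (SF : Set S),
      (L.program.atsoGame (PCS.programFinal SF)).DeadlockFree ∧
      ((∃ s ∈ SF, L.StateReachable (s₀, []) s) ↔
        (L.program.atsoGame (PCS.programFinal SF)).WinsB (Player.B, PCS.programInit s₀))) :=
  ⟨not_atsoSafetyDecidable, fun _ _ _ _ L s₀ SF =>
    ⟨L.deadlockFree SF, L.reachable_iff_winsB s₀ SF⟩⟩
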